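/- Theorem (torus condition). Let $f:\mathbb C\to\mathbb CP^2$ be a conformally parametrized minimal Lagrangian immersion (Fubini–Study metric of holomorphic sectional curvature $4$) which is translationally equivariant: there is a one-parameter subgroup $R$ of $SU(3)$ with $f(t+z)=R(t)f(z)$ for all $t\in\mathbb R$, $z\in\mathbb C$. Write the induced metric as $2e^{u}\,dz\,d\bar z$, where by equivariance $u=u(y)$, $y=\operatorname{Im} z$, and let $\psi\,dz^3$, $\psi=F_{zz}\cdot\overline{F_{\bar z}}$ for a horizontal lift $F:\mathbb C\to S^5$ of $f$, be its Hopf differential; $\psi$ is constant. Assume $\psi\neq0$ and that the origin is chosen so that $u'(0)=0$. For $|\lambda|=1$ let $f(\cdot,\lambda):\mathbb C\to\mathbb CP^2$ be the member of the associated family of $f$, that is, the minimal Lagrangian immersion, unique up to isometries, with the same metric and with Hopf differential $-i\lambda^{-3}\psi\,dz^3$. Put $a_1=e^{u(0)}$, $\beta=2a_1+|\psi|^2/a_1^2$, $c=\beta/2-a_1$, $$a_2=\tfrac12\big(c+\sqrt{c^2+4a_1c}\big),\quad a_3=\tfrac12\big(-c+\sqrt{c^2+4a_1c}\big),\quad k^2=\frac{a_1-a_2}{a_1+a_3},\quad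 r=\sqrt{2(a_1+a_3)},$$ $$T=\frac1r\int_0^{\pi/2}\frac{d\alpha}{\sqrt{1-k^2\sin^2\alpha}}$$ (if $u$ is not constant, $2T$ is its smallest period), and $$D(\lambda)=\begin{pmatrix}0&-i\lambda\bar\psi e^{-u(0)}&i\lambda^{-1}e^{u(0)/2}\\-i\lambda^{-1}\psi e^{-u(0)}&0&i\lambda e^{u(0)/2}\\ i\lambda e^{u(0)/2}&i\lambda^{-1}e^{u(0)/2}&0\end{pmatrix},\qquad \beta_2(2T,\lambda)=\int_0^{2T}\frac{2e^{u}}{\lambda^3\bar\psi-\lambda^{-3}\psi-e^{u}u'}\,dy,$$ the integral being convergent when $\lambda^{-3}\psi\notin\mathbb R$. Fix $\lambda_0$ with $|\lambda_0|=1$ and let $id_1,id_2,id_3$ be the (purely imaginary) eigenvalues of $D(\lambda_0)$, with multiplicity and in any order. Assume that $f$ is not flat (i.e. $u$ is not constant), or that $D(\lambda_0)$ has a multiple eigenvalue. Then $f(\cdot,\lambda_0)$ descends to a torus, i.e. it has two periods that are linearly independent over $\mathbb R$, if and only if both of the following hold: 1. $d_1$ and $d_2$ have a rational quotient: $d_2=0$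 or $d_1/d_2\in\mathbb Q$; 2. $d_1=d_2$, or $\lambda_0^{-3}\psi$ is real, or $\frac1{2\pi}\operatorname{Im}\beta_2(2T,\lambda_0)\,\big(d_1d_2+\tfrac{2\beta}{3}\big)$ is rational. -/

import Mathlib

open scoped ContDiff ComplexConjugate

namespace EquivMinLag

noncomputable section

/-- The Hermitian space `ℂ³`. -/
abbrev C3 : Type := EuclideanSpace ℂ (Fin 3)

/-- The complex projective plane. -/
abbrev CP2 : Type := Projectivization ℂ C3

/-- Partial derivatives with respect to the real coordinates of `z = x + i y`. -/
def dx (F : ℂ → C3) (z : ℂ) : C3 := fderiv ℝ F z 1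

def dy (F : ℂ → C3) (z : ℂ) : C3 := fderiv ℝ F z Complex.I

/-- The Wirtinger derivatives `F_z = (F_x - i F_y) / 2` and `F_{z̄} = (F_x + i F_y) / 2`. -/
def dz (F : ℂ → C3) (z : ℂ) : C3 := (1 / 2 : ℂ) • (dx F z - Complex.I • dy F z)

def dzbar (F : ℂ → C3) (z : ℂ) : C3 := (1 / 2 : ℂ) • (dx F z + Complex.I • dy F z)

/-- `F : ℂ → S⁵ ⊂ ℂ³` is a smooth lift of `f : ℂ → ℂP²` which is horizontal for the Hopf fibration
`S⁵ → ℂP²`. (Mathlib's `inner ℂ W Z` is `∑ Z_k conj W_k`, written `Z · W̄`.) -/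
structure IsHorizontalLift (f : ℂ → CP2) (F : ℂ → C3) : Prop where
  smooth : ContDiff ℝ ∞ F
  norm_eq_one : ∀ z, ‖F z‖ = 1
  lifts : ∀ z, (f z).submodule = Submodule.span ℂ {F z}
  horizontal_x : ∀ z, inner ℂ (F z) (dx F z) = 0
  horizontal_y : ∀ z, inner ℂ (F z) (dy F z) = 0

/-- `f : ℂ → ℂP²` is a conformally parametrized minimal Lagrangian immersion, with horizontal
lift `F`. As `ℂ` is simply connected, every Lagrangian immersion `ℂ → ℂP²` has such a
lift, unique up to a constant unit factor; the Hopf fibration being a Riemannian submersion onto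
`ℂP²` with the Fubini-Study metric of holomorphic sectional curvature `4`,
the metric, the Kähler form and the second fundamental form of `f` are read off from `F`. -/
structure IsMinimalLagrangian (f : ℂ → CP2) (F : ℂ → C3) : Prop where
  lift : IsHorizontalLift f F
  immersion : ∀ z, dx F z ≠ 0
  conformal_norm : ∀ z, ‖dx F z‖ = ‖dy F z‖
  conformal_angle : ∀ z, (inner ℂ (dx F z) (dy F z)).re = 0
  /-- The pullback of the Kähler form vanishes. -/
  lagrangian : ∀ z, (inner ℂ (dx F z) (dy F z)).im = 0
  /-- The mean curvature vector vanishes: up to vertical terms (multiples of `F`),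
  `F_xx + F_yy` is tangent to the surface. -/
  minimal : ∀ z, ∃ (a b : ℝ) (c : ℂ),
    dx (dx F) z + dy (dy F) z = (a : ℂ) • dx F z + (b : ℂ) • dy F z + c • F z

/-- The function `u` with induced metric `2 e^u dz dz̄`, that is `e^u = F_z · conj F_z`. -/
def logFactor (F : ℂ → C3) (z : ℂ) : ℝ := Real.log (‖dz F z‖ ^ 2)

/-- The coefficient `F_zz · conj F_z̄` of the Hopf differential. -/
def hopf (F : ℂ → C3) (z : ℂ) : ℂ := inner ℂ (dzbar F z) (dz (dz F) z)

/-- Equivariance under all real translations of the domain, relative to a one-parameter subgroup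
`R` of `SU(3)` acting on lines in `ℂ³`. -/
def IsTranslationallyEquivariant (f : ℂ → CP2) : Prop :=
  ∃ R : ℝ → Matrix.specialUnitaryGroup (Fin 3) ℂ, Continuous R ∧
    (∀ s t, R (s + t) = R s * R t) ∧
    ∀ (t : ℝ) (z : ℂ), (f (t + z)).submodule =
      (f z).submodule.map (Matrix.toEuclideanLin (R t : Matrix (Fin 3) (Fin 3) ℂ))

/-- The surfaces with horizontal lifts `F` and `G` have the same metric, and the Hopf differential
of the second one is `-i λ⁻³` times that of the first: for `|λ| = 1`, the second surface is the
member at the parameter `λ` of the associated family of the first one. -/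
def IsAssociate (lam : ℂ) (F G : ℂ → C3) : Prop :=
  ∀ z, logFactor G z = logFactor F z ∧ hopf G z = -Complex.I * lam⁻¹ ^ 3 * hopf F z

/-- Two periods that are linearly independent over `ℝ`. -/
def DescendsToTorus (f : ℂ → CP2) : Prop :=
  ∃ ω₁ ω₂ : ℂ, LinearIndependent ℝ ![ω₁, ω₂] ∧
    (∀ z, f (z + ω₁) = f z) ∧ ∀ z, f (z + ω₂) = f z

/-- The matrix `D(λ)` of the constant potential `D(λ) dz`, where `u0 = u(0)`. -/
def potential (psi : ℂ) (u0 : ℝ) (lam : ℂ) : Matrix (Fin 3) (Fin 3) ℂ :=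
  !![0, -Complex.I * lam * conj psi * (Real.exp (-u0) : ℂ),
      Complex.I * lam⁻¹ * (Real.exp (u0 / 2) : ℂ);
    -Complex.I * lam⁻¹ * psi * (Real.exp (-u0) : ℂ), 0,
      Complex.I * lam * (Real.exp (u0 / 2) : ℂ);
    Complex.I * lam * (Real.exp (u0 / 2) : ℂ),
      Complex.I * lam⁻¹ * (Real.exp (u0 / 2) : ℂ), 0]

/-- `β = 2 a₁ + |ψ|² / a₁²`, where `a₁ = e^{u(0)}`. -/
def betaConst (psi : ℂ) (a1 : ℝ) : ℝ := 2 * a1 + ‖psi‖ ^ 2 / a1 ^ 2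

/-- The numbers `a₂` and `a₃` with
`w³ - (β/2) w² + |ψ|²/2 = (w - a₁) (w - a₂) (w + a₃)`. -/
def a2 (psi : ℂ) (a1 : ℝ) : ℝ :=
  (betaConst psi a1 / 2 - a1 +
    √((betaConst psi a1 / 2 - a1) ^ 2 + 4 * a1 * (betaConst psi a1 / 2 - a1))) / 2

def a3 (psi : ℂ) (a1 : ℝ) : ℝ :=
  (-(betaConst psi a1 / 2 - a1) +
    √((betaConst psi a1 / 2 - a1) ^ 2 + 4 * a1 * (betaConst psi a1 / 2 - a1))) / 2

/-- The complete elliptic integral of the first kind, as a function of `m = k²`. -/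
def ellipticK (m : ℝ) : ℝ := ∫ t in (0 : ℝ)..(Real.pi / 2), 1 / √(1 - m * Real.sin t ^ 2)

/-- `T = K(k) / r` with `k² = (a₁ - a₂) / (a₁ + a₃)` and `r = √(2 (a₁ + a₃))`. -/
def halfPeriod (psi : ℂ) (a1 : ℝ) : ℝ :=
  ellipticK ((a1 - a2 psi a1) / (a1 + a3 psi a1)) / √(2 * (a1 + a3 psi a1))

/-- `β₂(y, λ) = ∫₀^y 2 e^u / (λ³ ψ̄ - λ⁻³ ψ - e^u u') ds`. For `|λ| = 1` the denominator has
imaginary part `-2 Im (λ⁻³ ψ)`, so it has no zeros when `λ⁻³ ψ` is not real. -/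
def beta2 (psi lam : ℂ) (u : ℝ → ℝ) (y : ℝ) : ℂ :=
  ∫ s in (0 : ℝ)..y, (2 * Real.exp (u s) : ℂ) /
    (lam ^ 3 * conj psi - lam⁻¹ ^ 3 * psi - (Real.exp (u s) * deriv u s : ℝ))

end

end EquivMinLag

open EquivMinLag

/-!
In the unitary frame spanned by `F`, `∂F` and `∂̄F`, the horizontal lift `F` of a minimal
Lagrangian surface satisfies structure equations that involve only the metric `w` and the Hopf
differential `ψ`. Hence surfaces with the same data are congruent, and a surface whose metric
depends on `y` alone is moved by a one-parameter group, with `F_x = M F` for a constant linear map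
`M`. At a critical point of `w` the matrix of `M` in the frame is the potential `D(λ)`, so the
eigenvalues of `M` are `i d_j`.

The Gauss equation integrates to `w'² = 4 β w² - 8 w³ - 4 |ψ|²`, which is solved by a squared
Jacobi sine: `w` is even and, unless constant, attains the value `w(0)` exactly on the multiples
of `2T`. Each period of the surface has an imaginary part `2nT`.

If the `d_j` are distinct, translations by `x` and by `2Ti` act diagonally on the coordinates of
`F` in an eigenbasis of `M`, and a translation is a period if and only if its three multipliers
agree. The multipliers of `x` are `exp (i d_j x)`; this gives the first condition. Each coordinate
solves a scalar linear equation in `y`, and its phase over `2T` is `d_j² J + d_j K` up to a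
constant, where `J = Im β₂(2T)`; this gives the second condition. When `λ⁻³ ψ` is real the
reflection `z ↦ z̄` extends to a congruence, and therefore `4Ti` is a period.

If two `d_j` agree, the discriminant of the characteristic polynomial forces `w³ = |ψ|²` and `λ⁻³
ψ` real. Then `w` is constant, and `F` is a sum of three exponentials, which has a lattice of
periods.
-/

namespace EquivMinLag

/-! ### Wirtinger calculus -/

section Wirtinger

lemma fderiv_comp_conj {V : Type*} [NormedAddCommGroup V] [NormedSpace ℝ V] (A : ℂ → V) (z v : ℂ) :
    fderiv ℝ (fun z => A (conj z)) z v = fderiv ℝ A (conj z) (conj v) := by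
  have := (Complex.conjCLE : ℂ ≃L[ℝ] ℂ).comp_right_fderiv (f := A) (x := z)
  exact congr($this v)

lemma fderiv_comp_im {V : Type*} [NormedAddCommGroup V] [NormedSpace ℝ V] {h : ℝ → V} {h' : V}
    {z : ℂ} (hh : HasDerivAt h h' z.im) (v : ℂ) :
    fderiv ℝ (fun z : ℂ => h z.im) z v = v.im • h' := by
  have := (hh.hasFDerivAt.comp z Complex.imCLM.hasFDerivAt).fderiv
  exact congr($this v)

lemma hasDerivAt_comp_line {V : Type*} [NormedAddCommGroup V] [NormedSpace ℝ V] {A : ℂ → V}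
    (hA : Differentiable ℝ A) (c v : ℂ) (t : ℝ) :
    HasDerivAt (fun t : ℝ => A (c + t * v)) (fderiv ℝ A (c + t * v) v) t := by
  have hline : HasDerivAt (fun t : ℝ => c + t * v) v t := by
    simpa using ((Complex.ofRealCLM.hasDerivAt (x := t)).mul_const v).const_add c
  exact (hA _).hasFDerivAt.comp_hasDerivAt t hline

lemma hasDerivAt_real_add {V : Type*} [NormedAddCommGroup V] [NormedSpace ℝ V] {A : ℂ → V}
    (hA : Differentiable ℝ A) (z : ℂ) :
    HasDerivAt (fun t : ℝ => A (t + z)) (fderiv ℝ A z 1) 0 := by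
  simpa [add_comm z] using hasDerivAt_comp_line hA z 1 0

variable {V : Type*} [NormedAddCommGroup V] [NormedSpace ℂ V] [NormedSpace ℝ V]

/-- The Wirtinger derivative `∂A = (A_x - i A_y) / 2` of a map from `ℂ` to a complex normed space;
on `ℂ³` it is `dz`. -/
noncomputable def wirtinger (A : ℂ → V) (z : ℂ) : V :=
  (1 / 2 : ℂ) • (fderiv ℝ A z 1 - Complex.I • fderiv ℝ A z Complex.I)

/-- The conjugate Wirtinger derivative `∂̄A = (A_x + i A_y) / 2`; on `ℂ³` it is `dzbar`. -/
noncomputable def wirtingerBar (A : ℂ → V) (z : ℂ) : V :=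
  (1 / 2 : ℂ) • (fderiv ℝ A z 1 + Complex.I • fderiv ℝ A z Complex.I)

lemma dz_eq_wirtinger : dz = wirtinger := rfl

variable {A B : ℂ → V} {z : ℂ}

lemma wirtinger_const (v : V) : wirtinger (fun _ => v) z = 0 := by simp [wirtinger]

lemma wirtingerBar_const (v : V) : wirtingerBar (fun _ => v) z = 0 := by simp [wirtingerBar]

lemma wirtinger_add (hA : DifferentiableAt ℝ A z) (hB : DifferentiableAt ℝ B z) :
    wirtinger (fun z => A z + B z) z = wirtinger A z + wirtinger B z := by
  simp only [wirtinger, fderiv_fun_add hA hB, add_apply]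
  module

lemma wirtingerBar_add (hA : DifferentiableAt ℝ A z) (hB : DifferentiableAt ℝ B z) :
    wirtingerBar (fun z => A z + B z) z = wirtingerBar A z + wirtingerBar B z := by
  simp only [wirtingerBar, fderiv_fun_add hA hB, add_apply]
  module

lemma wirtinger_comp_const_add (A : ℂ → V) (c z : ℂ) :
    wirtinger (fun z => A (c + z)) z = wirtinger A (c + z) := by
  simp [wirtinger, fderiv_comp_add_left]

lemma wirtingerBar_comp_const_add (A : ℂ → V) (c z : ℂ) :
    wirtingerBar (fun z => A (c + z)) z = wirtingerBar A (c + z) := by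
  simp [wirtingerBar, fderiv_comp_add_left]

lemma wirtinger_comp_conj (A : ℂ → V) (z : ℂ) :
    wirtinger (fun z => A (conj z)) z = wirtingerBar A (conj z) := by
  simp [wirtinger, wirtingerBar, fderiv_comp_conj, Complex.conj_I]

lemma wirtingerBar_comp_conj (A : ℂ → V) (z : ℂ) :
    wirtingerBar (fun z => A (conj z)) z = wirtinger A (conj z) := by
  simp [wirtinger, wirtingerBar, fderiv_comp_conj, Complex.conj_I, sub_eq_add_neg]

lemma wirtinger_comp_im {h : ℝ → V} {h' : V} (hh : HasDerivAt h h' z.im) :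
    wirtinger (fun z => h z.im) z = (-(Complex.I / 2)) • h' := by
  simp [wirtinger, fderiv_comp_im hh, smul_smul, div_eq_inv_mul]

lemma wirtingerBar_comp_im {h : ℝ → V} {h' : V} (hh : HasDerivAt h h' z.im) :
    wirtingerBar (fun z => h z.im) z = (Complex.I / 2) • h' := by
  simp [wirtingerBar, fderiv_comp_im hh, smul_smul, div_eq_inv_mul]

variable [IsScalarTower ℝ ℂ V]

lemma fderiv_apply_eq_wirtinger (A : ℂ → V) (z v : ℂ) :
    fderiv ℝ A z v = v • wirtinger A z + conj v • wirtingerBar A z := by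
  have hv : fderiv ℝ A z v = (v.re : ℂ) • fderiv ℝ A z 1 + (v.im : ℂ) • fderiv ℝ A z Complex.I := by
    rw [← Complex.coe_algebraMap, algebraMap_smul, algebraMap_smul, ← map_smul, ← map_smul,
      ← map_add]
    simp [Complex.re_add_im]
  rw [hv, wirtinger, wirtingerBar, Complex.re_eq_add_conj, Complex.im_eq_sub_conj]
  match_scalars
  · ring
  · field_simp
    linear_combination (v - conj v) * Complex.I_sq

lemma wirtinger_add_wirtingerBar (A : ℂ → V) (z : ℂ) :
    wirtinger A z + wirtingerBar A z = fderiv ℝ A z 1 := by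
  simp [fderiv_apply_eq_wirtinger A z 1]

lemma I_smul_wirtinger_sub_wirtingerBar (A : ℂ → V) (z : ℂ) :
    Complex.I • (wirtinger A z - wirtingerBar A z) = fderiv ℝ A z Complex.I := by
  simp [fderiv_apply_eq_wirtinger A z Complex.I, sub_eq_add_neg]

lemma eq_of_wirtinger_eq_zero (hA : Differentiable ℝ A) (h : ∀ z, wirtinger A z = 0)
    (h' : ∀ z, wirtingerBar A z = 0) (z z' : ℂ) : A z = A z' :=
  is_const_of_fderiv_eq_zero (𝕜 := ℝ) hA
    (fun z => by ext; all_goals simp [fderiv_apply_eq_wirtinger, h, h']) z z'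

lemma contDiff_wirtinger (hA : ContDiff ℝ ∞ A) : ContDiff ℝ ∞ (wirtinger A) := by
  have h := hA.fderiv_right (m := ∞) le_rfl
  exact ((h.clm_apply contDiff_const).sub ((h.clm_apply contDiff_const).const_smul _)).const_smul _

lemma contDiff_wirtingerBar (hA : ContDiff ℝ ∞ A) : ContDiff ℝ ∞ (wirtingerBar A) := by
  have h := hA.fderiv_right (m := ∞) le_rfl
  exact ((h.clm_apply contDiff_const).add ((h.clm_apply contDiff_const).const_smul _)).const_smul _

lemma wirtinger_smul {g : ℂ → ℂ} (hg : DifferentiableAt ℝ g z) (hA : DifferentiableAt ℝ A z) :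
    wirtinger (fun z => g z • A z) z = wirtinger g z • A z + g z • wirtinger A z := by
  simp only [wirtinger, fderiv_fun_smul hg hA, add_apply,
    smul_apply, ContinuousLinearMap.smulRight_apply, smul_eq_mul]
  module

lemma wirtingerBar_smul {g : ℂ → ℂ} (hg : DifferentiableAt ℝ g z) (hA : DifferentiableAt ℝ A z) :
    wirtingerBar (fun z => g z • A z) z = wirtingerBar g z • A z + g z • wirtingerBar A z := by
  simp only [wirtingerBar, fderiv_fun_smul hg hA, add_apply,
    smul_apply, ContinuousLinearMap.smulRight_apply, smul_eq_mul]
  module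

lemma wirtinger_clm_apply {W : Type*} [NormedAddCommGroup W] [NormedSpace ℂ W] [NormedSpace ℝ W]
    [IsScalarTower ℝ ℂ W] (L : V →L[ℂ] W) (hA : DifferentiableAt ℝ A z) :
    wirtinger (fun z => L (A z)) z = L (wirtinger A z) := by
  have h : fderiv ℝ (fun z => L (A z)) z = (L.restrictScalars ℝ).comp (fderiv ℝ A z) :=
    ((L.restrictScalars ℝ).hasFDerivAt.comp z hA.hasFDerivAt).fderiv
  simp [wirtinger, h]

lemma wirtingerBar_clm_apply {W : Type*} [NormedAddCommGroup W] [NormedSpace ℂ W]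
    [NormedSpace ℝ W] [IsScalarTower ℝ ℂ W] (L : V →L[ℂ] W) (hA : DifferentiableAt ℝ A z) :
    wirtingerBar (fun z => L (A z)) z = L (wirtingerBar A z) := by
  have h : fderiv ℝ (fun z => L (A z)) z = (L.restrictScalars ℝ).comp (fderiv ℝ A z) :=
    ((L.restrictScalars ℝ).hasFDerivAt.comp z hA.hasFDerivAt).fderiv
  simp [wirtingerBar, h]

lemma wirtinger_wirtingerBar_comm (hA : ContDiff ℝ ∞ A) (z : ℂ) :
    wirtinger (wirtingerBar A) z = wirtingerBar (wirtinger A) z := by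
  have happ (v : ℂ) : HasFDerivAt (fun z => fderiv ℝ A z v)
      ((fderiv ℝ (fderiv ℝ A) z).flip v) z := by
    have h := (hA.fderiv_right (m := ∞) le_rfl).differentiable (by simp) z
    simpa using h.hasFDerivAt.clm_apply (hasFDerivAt_const v z)
  have hsymm : fderiv ℝ (fderiv ℝ A) z 1 Complex.I = fderiv ℝ (fderiv ℝ A) z Complex.I 1 := by
    refine hA.contDiffAt.isSymmSndFDerivAt ?_ _ _
    rw [minSmoothness_of_isRCLikeNormedField]
    exact WithTop.coe_le_coe.2 le_top
  have hbar : HasFDerivAt (wirtingerBar A) _ z :=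
    ((happ 1).add ((happ Complex.I).const_smul Complex.I)).const_smul (1 / 2 : ℂ)
  have hdel : HasFDerivAt (wirtinger A) _ z :=
    ((happ 1).sub ((happ Complex.I).const_smul Complex.I)).const_smul (1 / 2 : ℂ)
  rw [wirtinger, wirtingerBar, hbar.fderiv, hdel.fderiv]
  simp only [smul_apply, add_apply, sub_apply, ContinuousLinearMap.flip_apply, hsymm]
  module

lemma laplacian_eq_wirtinger (hA : ContDiff ℝ ∞ A) (z : ℂ) :
    fderiv ℝ (fun z => fderiv ℝ A z 1) z 1 + fderiv ℝ (fun z => fderiv ℝ A z Complex.I) z Complex.I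
      = (4 : ℂ) • wirtinger (wirtingerBar A) z := by
  have hd : DifferentiableAt ℝ (wirtinger A) z := (contDiff_wirtinger hA).differentiable (by simp) z
  have hd' : DifferentiableAt ℝ (wirtingerBar A) z :=
    (contDiff_wirtingerBar hA).differentiable (by simp) z
  simp only [← wirtinger_add_wirtingerBar A, ← I_smul_wirtinger_sub_wirtingerBar A]
  rw [fderiv_fun_add hd hd', fderiv_fun_const_smul (hd.fun_sub hd'), fderiv_fun_sub hd hd']
  simp only [add_apply, sub_apply, smul_apply, fderiv_apply_eq_wirtinger,
    wirtinger_wirtingerBar_comm hA, map_one, Complex.conj_I]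
  match_scalars
  · linear_combination Complex.I_sq
  · linear_combination (-2 : ℂ) * Complex.I_sq
  · linear_combination Complex.I_sq

end Wirtinger

section Inner

variable {V : Type*} [NormedAddCommGroup V] [InnerProductSpace ℂ V] [NormedSpace ℝ V]
  {A B : ℂ → V} {z : ℂ}

lemma wirtinger_inner (hA : DifferentiableAt ℝ A z) (hB : DifferentiableAt ℝ B z) :
    wirtinger (fun z => inner ℂ (A z) (B z)) z =
      inner ℂ (wirtingerBar A z) (B z) + inner ℂ (A z) (wirtinger B z) := by
  simp only [wirtinger, wirtingerBar, fderiv_inner_apply ℂ hA hB, inner_smul_left,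
    inner_smul_right, inner_add_left, inner_sub_right, smul_eq_mul, map_div₀, map_one, map_ofNat,
    Complex.conj_I]
  ring

lemma wirtingerBar_inner (hA : DifferentiableAt ℝ A z) (hB : DifferentiableAt ℝ B z) :
    wirtingerBar (fun z => inner ℂ (A z) (B z)) z =
      inner ℂ (wirtinger A z) (B z) + inner ℂ (A z) (wirtingerBar B z) := by
  simp only [wirtinger, wirtingerBar, fderiv_inner_apply ℂ hA hB, inner_smul_left,
    inner_smul_right, inner_sub_left, inner_add_right, smul_eq_mul, map_div₀, map_one, map_ofNat,
    Complex.conj_I]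
  ring

end Inner

/-! ### Horizontal lifts -/

/-- `F : ℂ → S⁵` is a horizontal lift of a conformal minimal Lagrangian immersion with metric
`2 w dz dz̄` and Hopf differential `ψ dz³`. In contrast to `IsMinimalLagrangian`, the conditions are
expressed by Wirtinger derivatives of the lift alone, so that they pass to translates and to
reflections of the domain. -/
structure IsMinLagLift (F : ℂ → C3) (w : ℂ → ℝ) (ψ : ℂ → ℂ) : Prop where
  smooth : ContDiff ℝ ∞ F
  norm_eq_one : ∀ z, ‖F z‖ = 1
  inner_wirtinger : ∀ z, inner ℂ (F z) (wirtinger F z) = 0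
  inner_wirtingerBar : ∀ z, inner ℂ (F z) (wirtingerBar F z) = 0
  inner_wirtinger_wirtingerBar : ∀ z, inner ℂ (wirtinger F z) (wirtingerBar F z) = 0
  norm_sq_wirtinger : ∀ z, ‖wirtinger F z‖ ^ 2 = w z
  norm_sq_wirtingerBar : ∀ z, ‖wirtingerBar F z‖ ^ 2 = w z
  metric_pos : ∀ z, 0 < w z
  wirtinger_wirtingerBar : ∀ z, wirtinger (wirtingerBar F) z = (-w z : ℂ) • F z
  hopf : ∀ z, inner ℂ (wirtingerBar F z) (wirtinger (wirtinger F) z) = ψ z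

namespace IsHorizontalLift

variable {f : ℂ → CP2} {F : ℂ → C3} (h : IsHorizontalLift f F)
include h

lemma differentiable : Differentiable ℝ F := h.smooth.differentiable (by simp)

lemma inner_wirtinger (z : ℂ) : inner ℂ (F z) (wirtinger F z) = 0 := by
  have hx := h.horizontal_x z
  have hy := h.horizontal_y z
  rw [dx] at hx
  rw [dy] at hy
  rw [wirtinger, inner_smul_right, inner_sub_right, inner_smul_right, hx, hy]
  simp

lemma inner_wirtingerBar (z : ℂ) : inner ℂ (F z) (wirtingerBar F z) = 0 := by
  have hx := h.horizontal_x z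
  have hy := h.horizontal_y z
  rw [dx] at hx
  rw [dy] at hy
  rw [wirtingerBar, inner_smul_right, inner_add_right, inner_smul_right, hx, hy]
  simp

end IsHorizontalLift

lemma norm_sq_half_smul_add_smul {V : Type*} [NormedAddCommGroup V]
    [InnerProductSpace ℂ V] {x y : V} (hxy : inner ℂ x y = 0) (hn : ‖x‖ = ‖y‖)
    {ε : ℂ} (hε : ‖ε‖ = 1) : ‖(1 / 2 : ℂ) • (x + ε • y)‖ ^ 2 = ‖x‖ ^ 2 / 2 := by
  rw [norm_smul, mul_pow, norm_add_sq (𝕜 := ℂ), inner_smul_right, hxy, norm_smul, hε, ← hn]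
  norm_num
  ring

namespace IsMinimalLagrangian

variable {f : ℂ → CP2} {F : ℂ → C3} (h : IsMinimalLagrangian f F)
include h

lemma inner_dx_dy (z : ℂ) : inner ℂ (dx F z) (dy F z) = 0 :=
  Complex.ext (h.conformal_angle z) (h.lagrangian z)

lemma inner_wirtinger_wirtingerBar (z : ℂ) :
    inner ℂ (wirtinger F z) (wirtingerBar F z) = 0 := by
  have hxy := h.inner_dx_dy z
  have hyx : inner ℂ (dy F z) (dx F z) = 0 := inner_eq_zero_symm.1 hxy
  change inner ℂ ((1 / 2 : ℂ) • (dx F z - Complex.I • dy F z))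
    ((1 / 2 : ℂ) • (dx F z + Complex.I • dy F z)) = 0
  simp only [inner_smul_left, inner_smul_right, inner_sub_left, inner_add_right, hxy, hyx,
    inner_self_eq_norm_sq_to_K, h.conformal_norm z, map_div₀, map_one, map_ofNat, Complex.conj_I]
  linear_combination (1 / 4 : ℂ) * (‖dy F z‖ : ℂ) ^ 2 * Complex.I_sq

lemma norm_sq_wirtinger (z : ℂ) : ‖wirtinger F z‖ ^ 2 = ‖dx F z‖ ^ 2 / 2 := by
  rw [← norm_sq_half_smul_add_smul (h.inner_dx_dy z) (h.conformal_norm z)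
    (ε := -Complex.I) (by simp), neg_smul, ← sub_eq_add_neg]
  rfl

lemma norm_sq_wirtingerBar (z : ℂ) : ‖wirtingerBar F z‖ ^ 2 = ‖dx F z‖ ^ 2 / 2 := by
  rw [← norm_sq_half_smul_add_smul (h.inner_dx_dy z) (h.conformal_norm z)
    (ε := Complex.I) (by simp)]
  rfl

lemma exp_logFactor (z : ℂ) : Real.exp (logFactor F z) = ‖wirtinger F z‖ ^ 2 := by
  have := norm_pos_iff.2 (h.immersion z)
  exact Real.exp_log (by rw [dz_eq_wirtinger, h.norm_sq_wirtinger z]; positivity)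

lemma exists_wirtinger_wirtingerBar_eq (z : ℂ) : ∃ α γ δ : ℂ, γ = conj α ∧
    wirtinger (wirtingerBar F) z = α • wirtinger F z + γ • wirtingerBar F z + δ • F z := by
  obtain ⟨a, b, c, hmin⟩ := h.minimal z
  refine ⟨(a + b * Complex.I) / 4, _, c / 4, rfl, ?_⟩
  have hlap : dx (dx F) z + dy (dy F) z = (4 : ℂ) • wirtinger (wirtingerBar F) z :=
    laplacian_eq_wirtinger h.lift.smooth z
  have hx : dx F z = wirtinger F z + wirtingerBar F z := (wirtinger_add_wirtingerBar F z).symm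
  have hy : dy F z = Complex.I • (wirtinger F z - wirtingerBar F z) :=
    (I_smul_wirtinger_sub_wirtingerBar F z).symm
  rw [hlap, hx, hy] at hmin
  rw [← inv_smul_smul₀ (show (4 : ℂ) ≠ 0 by norm_num) (wirtinger (wirtingerBar F) z), hmin]
  simp only [map_div₀, map_add, map_mul, Complex.conj_ofReal, Complex.conj_I, map_ofNat]
  module

lemma wirtinger_wirtingerBar_eq (z : ℂ) :
    wirtinger (wirtingerBar F) z = (-(‖wirtinger F z‖ ^ 2) : ℂ) • F z := by
  obtain ⟨α, γ, δ, rfl, hR⟩ := h.exists_wirtinger_wirtingerBar_eq z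
  have hF := h.lift.differentiable z
  have hP := (contDiff_wirtinger h.lift.smooth).differentiable (by simp) z
  have hQ := (contDiff_wirtingerBar h.lift.smooth).differentiable (by simp) z
  have hFP := h.lift.inner_wirtinger z
  have hFQ := h.lift.inner_wirtingerBar z
  have hPF := inner_eq_zero_symm.1 hFP
  have hQQ : ‖wirtingerBar F z‖ = ‖wirtinger F z‖ := by
    rw [← sq_eq_sq₀ (norm_nonneg _) (norm_nonneg _), h.norm_sq_wirtinger, h.norm_sq_wirtingerBar]
  have hP0 : (‖wirtinger F z‖ : ℂ) ^ 2 ≠ 0 := by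
    rw [← Complex.ofReal_pow, ← h.exp_logFactor]
    exact Complex.ofReal_ne_zero.2 (Real.exp_ne_zero _)
  have hα : α = 0 := by
    have key := wirtinger_inner hP hQ
    simp only [h.inner_wirtinger_wirtingerBar, wirtinger_const,
      ← wirtinger_wirtingerBar_comm h.lift.smooth, hR, inner_add_left, inner_add_right,
      inner_smul_left, inner_smul_right, hFQ, hPF, inner_self_eq_norm_sq_to_K, hQQ,
      Complex.conj_conj] at key
    simpa [hP0] using key.symm
  have hδ : δ = -(‖wirtinger F z‖ : ℂ) ^ 2 := by
    have key := wirtinger_inner hF hQ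
    simp only [h.lift.inner_wirtingerBar, wirtinger_const, hR, hα, inner_add_right,
      inner_smul_right, inner_self_eq_norm_sq_to_K, h.lift.norm_eq_one, hQQ,
      RCLike.ofReal_one] at key
    linear_combination -key
  simp [hR, hα, hδ]

lemma isMinLagLift : IsMinLagLift F (fun z => Real.exp (logFactor F z)) (hopf F) where
  smooth := h.lift.smooth
  norm_eq_one := h.lift.norm_eq_one
  inner_wirtinger := h.lift.inner_wirtinger
  inner_wirtingerBar := h.lift.inner_wirtingerBar
  inner_wirtinger_wirtingerBar := h.inner_wirtinger_wirtingerBar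
  norm_sq_wirtinger z := (h.exp_logFactor z).symm
  norm_sq_wirtingerBar z := by
    rw [h.exp_logFactor, h.norm_sq_wirtinger, h.norm_sq_wirtingerBar]
  metric_pos z := Real.exp_pos _
  wirtinger_wirtingerBar z := by
    rw [h.wirtinger_wirtingerBar_eq, h.exp_logFactor, Complex.ofReal_pow]
  hopf _ := rfl

end IsMinimalLagrangian

/-! ### The structure equations -/

namespace IsMinLagLift

variable {F : ℂ → C3} {w : ℂ → ℝ} {ψ : ℂ → ℂ} (h : IsMinLagLift F w ψ)
include h

lemma contDiff_wirtinger : ContDiff ℝ ∞ (wirtinger F) := EquivMinLag.contDiff_wirtinger h.smooth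

lemma contDiff_wirtingerBar : ContDiff ℝ ∞ (wirtingerBar F) :=
  EquivMinLag.contDiff_wirtingerBar h.smooth

lemma differentiable : Differentiable ℝ F := h.smooth.differentiable (by simp)

lemma differentiable_wirtinger : Differentiable ℝ (wirtinger F) :=
  h.contDiff_wirtinger.differentiable (by simp)

lemma differentiable_wirtingerBar : Differentiable ℝ (wirtingerBar F) :=
  h.contDiff_wirtingerBar.differentiable (by simp)

lemma metric_ne_zero (z : ℂ) : (w z : ℂ) ≠ 0 := Complex.ofReal_ne_zero.2 (h.metric_pos z).ne'

lemma inner_self (z : ℂ) : inner ℂ (F z) (F z) = 1 := by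
  simp [inner_self_eq_norm_sq_to_K, h.norm_eq_one]

lemma inner_wirtinger_self (z : ℂ) : inner ℂ (wirtinger F z) (wirtinger F z) = w z := by
  rw [inner_self_eq_norm_sq_to_K, ← h.norm_sq_wirtinger]; simp

lemma inner_wirtingerBar_self (z : ℂ) : inner ℂ (wirtingerBar F z) (wirtingerBar F z) = w z := by
  rw [inner_self_eq_norm_sq_to_K, ← h.norm_sq_wirtingerBar]; simp

lemma inner_wirtinger_left (z : ℂ) : inner ℂ (wirtinger F z) (F z) = 0 :=
  inner_eq_zero_symm.1 (h.inner_wirtinger z)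

lemma inner_wirtingerBar_left (z : ℂ) : inner ℂ (wirtingerBar F z) (F z) = 0 :=
  inner_eq_zero_symm.1 (h.inner_wirtingerBar z)

lemma inner_wirtingerBar_wirtinger (z : ℂ) : inner ℂ (wirtingerBar F z) (wirtinger F z) = 0 :=
  inner_eq_zero_symm.1 (h.inner_wirtinger_wirtingerBar z)

lemma contDiff_metric : ContDiff ℝ ∞ w := by
  simp only [← funext h.norm_sq_wirtinger]
  exact h.contDiff_wirtinger.norm_sq ℂ

lemma differentiable_metric : Differentiable ℝ (fun z => (w z : ℂ)) :=
  Complex.ofRealCLM.differentiable.comp (h.contDiff_metric.differentiable (by simp))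

lemma wirtingerBar_wirtinger (z : ℂ) : wirtingerBar (wirtinger F) z = (-w z : ℂ) • F z := by
  rw [← wirtinger_wirtingerBar_comm h.smooth, h.wirtinger_wirtingerBar]

lemma inner_wirtinger_wirtinger (z : ℂ) : inner ℂ (F z) (wirtinger (wirtinger F) z) = 0 := by
  have key := wirtinger_inner (h.differentiable z) (h.differentiable_wirtinger z)
  simp only [h.inner_wirtinger, wirtinger_const, h.inner_wirtingerBar_wirtinger, zero_add] at key
  exact key.symm

lemma wirtinger_metric (z : ℂ) :
    wirtinger (fun z => (w z : ℂ)) z = inner ℂ (wirtinger F z) (wirtinger (wirtinger F) z) := by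
  simp only [← h.inner_wirtinger_self]
  rw [wirtinger_inner (h.differentiable_wirtinger z) (h.differentiable_wirtinger z),
    h.wirtingerBar_wirtinger, inner_smul_left, h.inner_wirtinger, mul_zero, zero_add]

lemma conj_wirtingerBar_metric (z : ℂ) :
    conj (wirtingerBar (fun z => (w z : ℂ)) z) = wirtinger (fun z => (w z : ℂ)) z := by
  simp only [← h.inner_wirtinger_self]
  rw [wirtinger_inner (h.differentiable_wirtinger z) (h.differentiable_wirtinger z),
    wirtingerBar_inner (h.differentiable_wirtinger z) (h.differentiable_wirtinger z), map_add,
    inner_conj_symm, inner_conj_symm, add_comm]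

lemma inner_wirtinger_wirtingerBar_wirtingerBar (z : ℂ) :
    inner ℂ (wirtinger F z) (wirtingerBar (wirtingerBar F) z) = -conj (ψ z) := by
  have key := wirtingerBar_inner (h.differentiable_wirtinger z) (h.differentiable_wirtingerBar z)
  simp only [h.inner_wirtinger_wirtingerBar, wirtingerBar_const,
    ← inner_conj_symm (wirtinger (wirtinger F) z), h.hopf] at key
  linear_combination -key

lemma comp_const_add (c : ℂ) :
    IsMinLagLift (fun z => F (c + z)) (fun z => w (c + z)) (fun z => ψ (c + z)) := by
  have h1 := funext (wirtinger_comp_const_add F c)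
  have h2 := funext (wirtingerBar_comp_const_add F c)
  refine ⟨h.smooth.comp (contDiff_const.add contDiff_id), fun z => h.norm_eq_one _, fun z => ?_,
    fun z => ?_, fun z => ?_, fun z => ?_, fun z => ?_, fun z => h.metric_pos _, fun z => ?_,
    fun z => ?_⟩
  · simp only [h1, h.inner_wirtinger]
  · simp only [h2, h.inner_wirtingerBar]
  · simp only [h1, h2, h.inner_wirtinger_wirtingerBar]
  · simp only [h1, h.norm_sq_wirtinger]
  · simp only [h2, h.norm_sq_wirtingerBar]
  · rw [h2, wirtinger_comp_const_add, h.wirtinger_wirtingerBar]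
  · rw [h1, h2, wirtinger_comp_const_add, h.hopf]

lemma comp_conj : IsMinLagLift (fun z => F (conj z)) (fun z => w (conj z))
    (fun z => -conj (ψ (conj z))) := by
  have h1 := funext (wirtinger_comp_conj F)
  have h2 := funext (wirtingerBar_comp_conj F)
  refine ⟨h.smooth.comp Complex.conjCLE.contDiff, fun z => h.norm_eq_one _, fun z => ?_,
    fun z => ?_, fun z => ?_, fun z => ?_, fun z => ?_, fun z => h.metric_pos _, fun z => ?_,
    fun z => ?_⟩
  · simp only [h1, h.inner_wirtingerBar]
  · simp only [h2, h.inner_wirtinger]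
  · simp only [h1, h2, h.inner_wirtingerBar_wirtinger]
  · simp only [h1, h.norm_sq_wirtingerBar]
  · simp only [h2, h.norm_sq_wirtinger]
  · rw [h2, wirtinger_comp_conj, h.wirtingerBar_wirtinger]
  · rw [h1, h2, wirtinger_comp_conj, h.inner_wirtinger_wirtingerBar_wirtingerBar]

lemma orthonormal_frame {lam : ℂ} (hlam : ‖lam‖ = 1) (z : ℂ) : Orthonormal ℂ
    ![(-Complex.I * lam / √(w z)) • wirtinger F z, (-Complex.I * lam⁻¹ / √(w z)) • wirtingerBar F z,
      F z] := by
  have hs : 0 < √(w z) := Real.sqrt_pos.2 (h.metric_pos z)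
  have hP : ‖wirtinger F z‖ = √(w z) := by rw [← h.norm_sq_wirtinger, Real.sqrt_sq (norm_nonneg _)]
  have hQ : ‖wirtingerBar F z‖ = √(w z) := by
    rw [← h.norm_sq_wirtingerBar, Real.sqrt_sq (norm_nonneg _)]
  constructor
  · intro i
    fin_cases i <;> simp [norm_smul, hlam, hP, hQ, h.norm_eq_one, abs_of_pos hs, hs.ne']
  · intro i j hij
    fin_cases i <;> fin_cases j <;>
      first
      | exact absurd rfl hij
      | simp [inner_smul_left, inner_smul_right, h.inner_wirtinger, h.inner_wirtingerBar,
          h.inner_wirtinger_left, h.inner_wirtingerBar_left, h.inner_wirtinger_wirtingerBar,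
          h.inner_wirtingerBar_wirtinger]

/-- The unitary frame `(-iλ F_z / √w, -iλ⁻¹ F_z̄ / √w, F)` along the surface; the factors are those
for which the Maurer-Cartan form of an associate is the potential `D(λ)`. -/
noncomputable def frame {lam : ℂ} (hlam : ‖lam‖ = 1) (z : ℂ) : OrthonormalBasis (Fin 3) ℂ C3 :=
  OrthonormalBasis.mk (h.orthonormal_frame hlam z)
    ((h.orthonormal_frame hlam z).linearIndependent.span_eq_top_of_card_eq_finrank (by simp)).ge

lemma coe_frame {lam : ℂ} (hlam : ‖lam‖ = 1) (z : ℂ) : ⇑(h.frame hlam z) =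
    ![(-Complex.I * lam / √(w z)) • wirtinger F z, (-Complex.I * lam⁻¹ / √(w z)) • wirtingerBar F z,
      F z] :=
  OrthonormalBasis.coe_mk _ _

lemma frame_expansion (z : ℂ) (v : C3) : v = inner ℂ (F z) v • F z +
    inner ℂ (wirtinger F z) v • (w z : ℂ)⁻¹ • wirtinger F z +
    inner ℂ (wirtingerBar F z) v • (w z : ℂ)⁻¹ • wirtingerBar F z := by
  have hs : (√(w z) : ℂ) ^ 2 = w z := by
    rw [← Complex.ofReal_pow, Real.sq_sqrt (h.metric_pos z).le]
  conv_lhs => rw [← (h.frame norm_one z).sum_repr' v, Fin.sum_univ_three, h.coe_frame]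
  simp only [mul_one, inv_one, Matrix.cons_val_zero, inner_smul_left, map_div₀, map_neg,
    Complex.conj_I, neg_neg, Complex.conj_ofReal, smul_smul, Matrix.cons_val_one, Matrix.cons_val,
    ← hs]
  match_scalars
  · linear_combination (-(√(w z) : ℂ)⁻¹ ^ 2 * inner ℂ (wirtinger F z) v) * Complex.I_sq
  · linear_combination (-(√(w z) : ℂ)⁻¹ ^ 2 * inner ℂ (wirtingerBar F z) v) * Complex.I_sq
  · ring

lemma ext_inner {z : ℂ} {v v' : C3} (hF : inner ℂ (F z) v = inner ℂ (F z) v')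
    (hP : inner ℂ (wirtinger F z) v = inner ℂ (wirtinger F z) v')
    (hQ : inner ℂ (wirtingerBar F z) v = inner ℂ (wirtingerBar F z) v') : v = v' := by
  rw [h.frame_expansion z v, hF, hP, hQ, ← h.frame_expansion]

lemma smul_wirtinger_wirtinger (z : ℂ) : (w z : ℂ) • wirtinger (wirtinger F) z =
    wirtinger (fun z => (w z : ℂ)) z • wirtinger F z + ψ z • wirtingerBar F z := by
  refine h.ext_inner (z := z) ?_ ?_ ?_
  · simp only [inner_add_right, inner_smul_right, h.inner_wirtinger_wirtinger, h.inner_wirtinger,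
      h.inner_wirtingerBar]
    ring
  · simp only [inner_add_right, inner_smul_right, h.inner_wirtinger_self, ← h.wirtinger_metric,
      h.inner_wirtinger_wirtingerBar]
    ring
  · simp only [inner_add_right, inner_smul_right, h.inner_wirtingerBar_self, h.hopf,
      h.inner_wirtingerBar_wirtinger]
    ring

lemma smul_wirtingerBar_wirtingerBar (z : ℂ) : (w z : ℂ) • wirtingerBar (wirtingerBar F) z =
    wirtingerBar (fun z => (w z : ℂ)) z • wirtingerBar F z - conj (ψ z) • wirtinger F z := by
  have key := h.comp_conj.smul_wirtinger_wirtinger (conj z)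
  rw [funext (wirtinger_comp_conj F), wirtinger_comp_conj,
    wirtinger_comp_conj (fun z => (w z : ℂ)), wirtingerBar_comp_conj] at key
  simpa [sub_eq_add_neg] using key

lemma wirtingerBar_wirtinger_wirtinger (z : ℂ) : wirtingerBar (wirtinger (wirtinger F)) z =
    -(wirtinger (fun z => (w z : ℂ)) z • F z + (w z : ℂ) • wirtinger F z) := by
  have hneg : wirtingerBar (wirtinger F) = fun z => (-1 : ℂ) • (w z : ℂ) • F z := by
    ext1 z
    rw [h.wirtingerBar_wirtinger, neg_one_smul, neg_smul]
  rw [← wirtinger_wirtingerBar_comm h.contDiff_wirtinger, hneg,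
    wirtinger_smul (differentiableAt_const _)
      ((h.differentiable_metric z).fun_smul (h.differentiable z)),
    wirtinger_const, wirtinger_smul (h.differentiable_metric z) (h.differentiable z)]
  module

lemma wirtingerBar_hopf (z : ℂ) : wirtingerBar ψ z = 0 := by
  rw [← funext h.hopf, wirtingerBar_inner (h.differentiable_wirtingerBar z)
    ((EquivMinLag.contDiff_wirtinger h.contDiff_wirtinger).differentiable (by simp) z),
    h.wirtinger_wirtingerBar, h.wirtingerBar_wirtinger_wirtinger]
  simp only [inner_smul_left, inner_smul_right, inner_add_right, inner_neg_right,
    h.inner_wirtinger_wirtinger, h.inner_wirtingerBar_left, h.inner_wirtingerBar_wirtinger]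
  ring

lemma gauss_equation (z : ℂ) :
    (w z : ℂ) * wirtingerBar (wirtinger fun z => (w z : ℂ)) z =
      ‖wirtinger (fun z => (w z : ℂ)) z‖ ^ 2 + ‖ψ z‖ ^ 2 - (w z : ℂ) ^ 3 := by
  have hnorm := congr(inner ℂ $(h.smul_wirtinger_wirtinger z) $(h.smul_wirtinger_wirtinger z))
  simp only [inner_add_left, inner_add_right, inner_smul_left, inner_smul_right,
    h.inner_wirtinger_self, h.inner_wirtingerBar_self, h.inner_wirtinger_wirtingerBar,
    h.inner_wirtingerBar_wirtinger, Complex.conj_ofReal] at hnorm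
  rw [← Complex.conj_mul', ← Complex.conj_mul']
  nth_rewrite 1 [funext h.wirtinger_metric]
  rw [wirtingerBar_inner (h.differentiable_wirtinger z)
    ((EquivMinLag.contDiff_wirtinger h.contDiff_wirtinger).differentiable (by simp) z),
    h.wirtingerBar_wirtinger_wirtinger]
  simp only [inner_neg_right, inner_add_right, inner_smul_right, h.inner_wirtinger_left,
    h.inner_wirtinger_self]
  apply mul_left_cancel₀ (h.metric_ne_zero z)
  linear_combination hnorm

end IsMinLagLift

/-! ### Congruence of surfaces with the same metric and Hopf differential -/

namespace IsMinLagLift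

variable {F G : ℂ → C3} {w : ℂ → ℝ} {ψ : ℂ → ℂ} (h : IsMinLagLift F w ψ) (h' : IsMinLagLift G w ψ)

/-- The unitary map carrying the frame of `F` at `z` to the frame of `G` at `z`. It turns out not to
depend on `z`, which makes `F` and `G` congruent. -/
noncomputable def transport (z : ℂ) : C3 ≃ₗᵢ[ℂ] C3 :=
  (h.frame norm_one z).equiv (h'.frame norm_one z) (Equiv.refl _)

lemma transport_apply (z : ℂ) (v : C3) : h.transport h' z v = inner ℂ (F z) v • G z +
    inner ℂ (wirtinger F z) v • (w z : ℂ)⁻¹ • wirtinger G z +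
    inner ℂ (wirtingerBar F z) v • (w z : ℂ)⁻¹ • wirtingerBar G z := by
  have hs : (√(w z) : ℂ) ^ 2 = w z := by
    rw [← Complex.ofReal_pow, Real.sq_sqrt (h.metric_pos z).le]
  rw [transport, OrthonormalBasis.equiv_apply, Fin.sum_univ_three]
  simp only [OrthonormalBasis.repr_apply_apply, coe_frame, Equiv.refl_apply, mul_one, inv_one,
    Matrix.cons_val_zero, inner_smul_left, map_div₀, map_neg, Complex.conj_I, neg_neg,
    Complex.conj_ofReal, smul_smul, Matrix.cons_val_one, Matrix.cons_val, ← hs]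
  match_scalars
  · linear_combination (-(√(w z) : ℂ)⁻¹ ^ 2 * inner ℂ (wirtinger F z) v) * Complex.I_sq
  · linear_combination (-(√(w z) : ℂ)⁻¹ ^ 2 * inner ℂ (wirtingerBar F z) v) * Complex.I_sq
  · ring

lemma transport_comp_conj (z : ℂ) (v : C3) :
    h.comp_conj.transport h'.comp_conj z v = h.transport h' (conj z) v := by
  simp only [transport_apply, wirtinger_comp_conj, wirtingerBar_comp_conj]
  abel

include h in
lemma wirtinger_inv_metric (z : ℂ) : wirtinger (fun z => (w z : ℂ)⁻¹) z =
    -(w z : ℂ)⁻¹ ^ 2 * wirtinger (fun z => (w z : ℂ)) z := by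
  have hw := h.differentiable_metric z
  have hinv : DifferentiableAt ℝ (fun z => (w z : ℂ)⁻¹) z := hw.fun_inv (h.metric_ne_zero z)
  have key := wirtinger_smul hw hinv
  simp only [smul_eq_mul, mul_inv_cancel₀ (h.metric_ne_zero _), wirtinger_const] at key
  linear_combination (-(w z : ℂ)⁻¹) * key -
    wirtinger (fun z => (w z : ℂ)⁻¹) z * inv_mul_cancel₀ (h.metric_ne_zero z)

include h in
lemma differentiableAt_inv_metric (z : ℂ) : DifferentiableAt ℝ (fun z => (w z : ℂ)⁻¹) z :=
  (h.differentiable_metric z).fun_inv (h.metric_ne_zero z)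

include h in
lemma wirtinger_inv_metric_smul_wirtinger (z : ℂ) :
    wirtinger (fun z => (w z : ℂ)⁻¹ • wirtinger F z) z =
      ((w z : ℂ)⁻¹ ^ 2 * ψ z) • wirtingerBar F z := by
  have hw := h.metric_ne_zero z
  rw [wirtinger_smul (h.differentiableAt_inv_metric z) (h.differentiable_wirtinger z),
    h.wirtinger_inv_metric, ← inv_smul_smul₀ hw (wirtinger (wirtinger F) z),
    h.smul_wirtinger_wirtinger]
  module

include h in
lemma wirtinger_inv_metric_smul_wirtingerBar (z : ℂ) :
    wirtinger (fun z => (w z : ℂ)⁻¹ • wirtingerBar F z) z =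
      -(((w z : ℂ)⁻¹ ^ 2 * wirtinger (fun z => (w z : ℂ)) z) • wirtingerBar F z) - F z := by
  rw [wirtinger_smul (h.differentiableAt_inv_metric z) (h.differentiable_wirtingerBar z),
    h.wirtinger_inv_metric, h.wirtinger_wirtingerBar, smul_smul, mul_neg,
    inv_mul_cancel₀ (h.metric_ne_zero z)]
  module

include h in
lemma inner_wirtingerBar_wirtingerBar (z : ℂ) (v : C3) :
    inner ℂ (wirtingerBar (wirtingerBar F) z) v =
      (w z : ℂ)⁻¹ * (wirtinger (fun z => (w z : ℂ)) z * inner ℂ (wirtingerBar F z) v -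
        ψ z * inner ℂ (wirtinger F z) v) := by
  rw [← inv_smul_smul₀ (h.metric_ne_zero z) (wirtingerBar (wirtingerBar F) z),
    h.smul_wirtingerBar_wirtingerBar, inner_smul_left, inner_sub_left, inner_smul_left,
    inner_smul_left, h.conj_wirtingerBar_metric, map_inv₀, Complex.conj_ofReal,
    Complex.conj_conj]

lemma wirtinger_transport (v : C3) (z : ℂ) : wirtinger (fun z => h.transport h' z v) z = 0 := by
  have hc := differentiableAt_const (𝕜 := ℝ) (x := z) v
  have hF := (h.differentiable z).inner ℂ hc
  have hP := (h.differentiable_wirtinger z).inner ℂ hc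
  have hQ := (h.differentiable_wirtingerBar z).inner ℂ hc
  have hw := h.differentiableAt_inv_metric z
  have hG := h'.differentiable z
  have hP' := hw.fun_smul (h'.differentiable_wirtinger z)
  have hQ' := hw.fun_smul (h'.differentiable_wirtingerBar z)
  have hw0 := h.metric_ne_zero z
  simp only [transport_apply]
  rw [wirtinger_add ((hF.fun_smul hG).fun_add (hP.fun_smul hP')) (hQ.fun_smul hQ'),
    wirtinger_add (hF.fun_smul hG) (hP.fun_smul hP'), wirtinger_smul hF hG, wirtinger_smul hP hP',
    wirtinger_smul hQ hQ', wirtinger_inner (h.differentiable z) hc,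
    wirtinger_inner (h.differentiable_wirtinger z) hc,
    wirtinger_inner (h.differentiable_wirtingerBar z) hc, wirtinger_const,
    h.wirtingerBar_wirtinger, h.inner_wirtingerBar_wirtingerBar,
    h'.wirtinger_inv_metric_smul_wirtinger, h'.wirtinger_inv_metric_smul_wirtingerBar,
    inner_smul_left, map_neg, Complex.conj_ofReal]
  simp only [inner_zero_right]
  match_scalars <;> field_simp <;> ring

lemma transport_eq (z z' : ℂ) : h.transport h' z = h.transport h' z' := by
  ext1 v
  have hdiff : Differentiable ℝ fun z => h.transport h' z v := by
    have hc := differentiable_const (𝕜 := ℝ) (E := ℂ) v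
    have hw := h.differentiableAt_inv_metric
    simp only [transport_apply]
    exact (((h.differentiable.inner ℂ hc).fun_smul h'.differentiable).fun_add
      ((h.differentiable_wirtinger.inner ℂ hc).fun_smul
        (Differentiable.fun_smul hw h'.differentiable_wirtinger))).fun_add
      ((h.differentiable_wirtingerBar.inner ℂ hc).fun_smul
        (Differentiable.fun_smul hw h'.differentiable_wirtingerBar))
  refine eq_of_wirtinger_eq_zero hdiff (h.wirtinger_transport h' v) (fun z => ?_) z z'
  have key := h.comp_conj.wirtinger_transport h'.comp_conj v (conj z)
  rwa [funext fun z => h.transport_comp_conj h' z v,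
    wirtinger_comp_conj (fun z => h.transport h' z v), Complex.conj_conj] at key

theorem transport_apply_self (z z' : ℂ) : h.transport h' z (F z') = G z' := by
  rw [h.transport_eq h' z z', transport_apply, h.inner_self, h.inner_wirtinger_left,
    h.inner_wirtingerBar_left]
  module

end IsMinLagLift

/-! ### Uniqueness of horizontal lifts, periods and equivariance -/

namespace IsHorizontalLift

variable {f g : ℂ → CP2} {F G : ℂ → C3}

lemma comp_const_add (h : IsHorizontalLift f F) (c : ℂ) :
    IsHorizontalLift (fun z => f (c + z)) (fun z => F (c + z)) where
  smooth := h.smooth.comp (contDiff_const.add contDiff_id)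
  norm_eq_one _ := h.norm_eq_one _
  lifts _ := h.lifts _
  horizontal_x z := by simpa only [dx, fderiv_comp_add_left] using h.horizontal_x (c + z)
  horizontal_y z := by simpa only [dy, fderiv_comp_add_left] using h.horizontal_y (c + z)

lemma linearIsometry_comp (h : IsHorizontalLift f F) (U : C3 →ₗᵢ[ℂ] C3)
    (hg : ∀ z, (g z).submodule = (f z).submodule.map U.toLinearMap) :
    IsHorizontalLift g (fun z => U (F z)) := by
  have hfderiv (z v : ℂ) : fderiv ℝ (fun z => U (F z)) z v = U (fderiv ℝ F z v) :=
    congr($(((U.toContinuousLinearMap.restrictScalars ℝ).hasFDerivAt.comp z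
      (h.differentiable z).hasFDerivAt).fderiv) v)
  refine ⟨(U.toContinuousLinearMap.restrictScalars ℝ).contDiff.comp h.smooth, fun z => ?_,
    fun z => ?_, fun z => ?_, fun z => ?_⟩
  · rw [U.norm_map, h.norm_eq_one]
  · rw [hg, h.lifts, Submodule.map_span, Set.image_singleton]
    rfl
  · rw [dx, hfderiv, U.inner_map_map]
    exact h.horizontal_x z
  · rw [dy, hfderiv, U.inner_map_map]
    exact h.horizontal_y z

lemma exists_eq_smul (hF : IsHorizontalLift f F) (hG : IsHorizontalLift f G) :
    ∃ c : ℂ, ‖c‖ = 1 ∧ ∀ z, G z = c • F z := by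
  have hmem (z : ℂ) : ∃ c : ℂ, c • F z = G z := by
    rw [← Submodule.mem_span_singleton, ← hF.lifts, hG.lifts]
    exact Submodule.mem_span_singleton_self _
  choose c hc using hmem
  have hnorm (z : ℂ) : ‖c z‖ = 1 := by
    simpa [norm_smul, hF.norm_eq_one, hG.norm_eq_one] using congr(‖$(hc z)‖)
  have hFG (z : ℂ) : F z = conj (c z) • G z := by
    simp [← hc, smul_smul, Complex.conj_mul', hnorm]
  have hcoeff (z : ℂ) : c z = inner ℂ (F z) (G z) := by
    simp [← hc, inner_self_eq_norm_sq_to_K, hF.norm_eq_one]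
  have hconst (z : ℂ) : c z = c 0 := by
    simp only [hcoeff]
    refine eq_of_wirtinger_eq_zero (A := fun z => inner ℂ (F z) (G z))
      (hF.differentiable.inner ℂ hG.differentiable) (fun z => ?_) (fun z => ?_) z 0
    · rw [wirtinger_inner (hF.differentiable z) (hG.differentiable z), ← hc z, inner_smul_right,
        inner_eq_zero_symm.1 (hF.inner_wirtingerBar z), hFG z, inner_smul_left,
        hG.inner_wirtinger]
      simp
    · rw [wirtingerBar_inner (hF.differentiable z) (hG.differentiable z), ← hc z, inner_smul_right,
        inner_eq_zero_symm.1 (hF.inner_wirtinger z), hFG z, inner_smul_left,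
        hG.inner_wirtingerBar]
      simp
  exact ⟨c 0, hnorm 0, fun z => by rw [← hc, hconst]⟩

lemma period_iff (h : IsHorizontalLift f F) (τ : ℂ) :
    (∀ z, f (z + τ) = f z) ↔ ∃ c : ℂ, ‖c‖ = 1 ∧ ∀ z, F (τ + z) = c • F z := by
  constructor
  · intro hτ
    have hfτ : (fun z => f (τ + z)) = f := funext fun z => by rw [add_comm, hτ]
    exact h.exists_eq_smul (hfτ ▸ h.comp_const_add τ)
  · rintro ⟨c, hc, hF⟩ z
    apply Projectivization.submodule_injective
    rw [h.lifts, h.lifts, add_comm, hF,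
      Submodule.span_singleton_smul_eq (IsUnit.mk0 c (norm_ne_zero_iff.1 (by simp [hc])))]

lemma exists_linearIsometry_translation (h : IsHorizontalLift f F)
    (he : IsTranslationallyEquivariant f) (t : ℝ) :
    ∃ U : C3 →ₗᵢ[ℂ] C3, ∀ z, F (t + z) = U (F z) := by
  obtain ⟨R, -, -, hR⟩ := he
  have hinner (v v' : C3) : inner ℂ (Matrix.toEuclideanLin (R t : Matrix (Fin 3) (Fin 3) ℂ) v)
      (Matrix.toEuclideanLin (R t : Matrix (Fin 3) (Fin 3) ℂ) v') = inner ℂ v v' := by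
    have hunitary : (R t : Matrix (Fin 3) (Fin 3) ℂ).conjTranspose * R t = 1 :=
      (Matrix.mem_specialUnitaryGroup_iff.1 (R t).2).1.1
    rw [← LinearMap.adjoint_inner_right, ← Matrix.toEuclideanLin_conjTranspose_eq_adjoint]
    congr 1
    ext i
    simp [Matrix.toLpLin_apply, hunitary]
  let U := (Matrix.toEuclideanLin (R t : Matrix (Fin 3) (Fin 3) ℂ)).isometryOfInner hinner
  obtain ⟨c, hc, hcF⟩ := (h.linearIsometry_comp U (hR t)).exists_eq_smul (h.comp_const_add t)
  have hcU (v v' : C3) : inner ℂ ((c • U.toLinearMap) v) ((c • U.toLinearMap) v') =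
      inner ℂ v v' := by
    have hcc : conj c * c = 1 := by rw [Complex.conj_mul', hc]; simp
    rw [LinearMap.smul_apply, LinearMap.smul_apply, inner_smul_left, inner_smul_right, ← mul_assoc,
      hcc, one_mul]
    exact U.inner_map_map v v'
  exact ⟨(c • U.toLinearMap).isometryOfInner hcU, hcF⟩

end IsHorizontalLift

namespace IsMinLagLift

variable {f : ℂ → CP2} {F : ℂ → C3} {w : ℂ → ℝ} {ψ : ℂ → ℂ}

lemma metric_hopf_add (h : IsMinLagLift F w ψ) {c : ℂ} {U : C3 →ₗᵢ[ℂ] C3}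
    (hU : ∀ z, F (c + z) = U (F z)) (z : ℂ) : w (c + z) = w z ∧ ψ (c + z) = ψ z := by
  have hP (z : ℂ) : wirtinger F (c + z) = U (wirtinger F z) := by
    rw [← wirtinger_comp_const_add, funext hU]
    exact wirtinger_clm_apply U.toContinuousLinearMap (h.differentiable z)
  have hQ (z : ℂ) : wirtingerBar F (c + z) = U (wirtingerBar F z) := by
    rw [← wirtingerBar_comp_const_add, funext hU]
    exact wirtingerBar_clm_apply U.toContinuousLinearMap (h.differentiable z)
  have hPP : wirtinger (wirtinger F) (c + z) = U (wirtinger (wirtinger F) z) := by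
    rw [← wirtinger_comp_const_add, funext hP]
    exact wirtinger_clm_apply U.toContinuousLinearMap (h.differentiable_wirtinger z)
  rw [← h.norm_sq_wirtinger, ← h.norm_sq_wirtinger, ← h.hopf, ← h.hopf, hP, hQ, hPP, U.norm_map,
    U.inner_map_map]
  exact ⟨rfl, rfl⟩

lemma contDiff_hopf (h : IsMinLagLift F w ψ) : ContDiff ℝ ∞ ψ := by
  rw [← funext h.hopf]
  exact h.contDiff_wirtingerBar.inner ℂ (EquivMinLag.contDiff_wirtinger h.contDiff_wirtinger)

lemma hopf_eq_of_translation_invariant (h : IsMinLagLift F w ψ)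
    (hinv : ∀ (t : ℝ) z, ψ (t + z) = ψ z) (z z' : ℂ) : ψ z = ψ z' := by
  have hd : Differentiable ℝ ψ := h.contDiff_hopf.differentiable (by simp)
  refine eq_of_wirtinger_eq_zero hd (fun z => ?_) h.wirtingerBar_hopf z z'
  have hline := hasDerivAt_real_add hd z
  simp only [hinv] at hline
  have hx : fderiv ℝ ψ z 1 = 0 := hline.unique (hasDerivAt_const _ _)
  rwa [← wirtinger_add_wirtingerBar, h.wirtingerBar_hopf, add_zero] at hx

end IsMinLagLift

/-! ### The infinitesimal generator of the translations -/

namespace IsMinLagLift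

lemma translation_eq {F : ℂ → C3} {w : ℂ → ℝ} {ψ : ℂ} (h : IsMinLagLift F w fun _ => ψ) {c : ℂ}
    (hc : ∀ z, w (c + z) = w z) : IsMinLagLift (fun z => F (c + z)) w fun _ => ψ := by
  simpa only [hc] using h.comp_const_add c

lemma exists_generator {F : ℂ → C3} {w : ℂ → ℝ} {ψ : ℂ} (h : IsMinLagLift F w fun _ => ψ)
    (hw : ∀ (t : ℝ) z, w (t + z) = w z) : ∃ M : C3 →L[ℂ] C3, ∀ z, fderiv ℝ F z 1 = M (F z) := by
  refine ⟨(innerSL ℂ (F 0)).smulRight (fderiv ℝ F 0 1) +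
    (innerSL ℂ (wirtinger F 0)).smulRight ((w 0 : ℂ)⁻¹ • fderiv ℝ (wirtinger F) 0 1) +
    (innerSL ℂ (wirtingerBar F 0)).smulRight ((w 0 : ℂ)⁻¹ • fderiv ℝ (wirtingerBar F) 0 1),
    fun z => ?_⟩
  have htranslate (t : ℝ) : inner ℂ (F 0) (F z) • F (t + 0) +
      inner ℂ (wirtinger F 0) (F z) • (w 0 : ℂ)⁻¹ • wirtinger F (t + 0) +
      inner ℂ (wirtingerBar F 0) (F z) • (w 0 : ℂ)⁻¹ • wirtingerBar F (t + 0) = F (t + z) := by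
    rw [← wirtinger_comp_const_add, ← wirtingerBar_comp_const_add, ← transport_apply h
      (h.translation_eq (hw t)) 0, transport_apply_self]
  refine (hasDerivAt_real_add h.differentiable z).unique ?_
  simp only [← htranslate]
  have hF := (hasDerivAt_real_add h.differentiable 0).fun_const_smul (inner ℂ (F 0) (F z))
  have hP := ((hasDerivAt_real_add h.differentiable_wirtinger 0).fun_const_smul
    (w 0 : ℂ)⁻¹).fun_const_smul (inner ℂ (wirtinger F 0) (F z))
  have hQ := ((hasDerivAt_real_add h.differentiable_wirtingerBar 0).fun_const_smul
    (w 0 : ℂ)⁻¹).fun_const_smul (inner ℂ (wirtingerBar F 0) (F z))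
  exact ((hF.fun_add hP).fun_add hQ).congr_deriv (by
    simp only [add_apply, ContinuousLinearMap.smulRight_apply, innerSL_apply_apply])

variable {F : ℂ → C3} {w : ℂ → ℝ} {ψ : ℂ → ℂ}

lemma clm_ext (h : IsMinLagLift F w ψ) {E : Type*} [NormedAddCommGroup E] [NormedSpace ℂ E]
    [NormedSpace ℝ E] [IsScalarTower ℝ ℂ E] {L L' : C3 →L[ℂ] E} (hL : ∀ z, L (F z) = L' (F z)) :
    L = L' := by
  have hP : L (wirtinger F 0) = L' (wirtinger F 0) := by
    rw [← wirtinger_clm_apply L (h.differentiable 0), funext hL,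
      wirtinger_clm_apply L' (h.differentiable 0)]
  have hQ : L (wirtingerBar F 0) = L' (wirtingerBar F 0) := by
    rw [← wirtingerBar_clm_apply L (h.differentiable 0), funext hL,
      wirtingerBar_clm_apply L' (h.differentiable 0)]
  ext v
  rw [h.frame_expansion 0 v]
  simp only [map_add, map_smul, hP, hQ, hL]

lemma generator_apply {F : ℂ → C3} {M : C3 →L[ℂ] C3} (hM : ∀ z, fderiv ℝ F z 1 = M (F z)) (z : ℂ) :
    M (F z) = wirtinger F z + wirtingerBar F z := by
  rw [← hM, wirtinger_add_wirtingerBar]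

variable (h : IsMinLagLift F w ψ) {M : C3 →L[ℂ] C3} (hM : ∀ z, fderiv ℝ F z 1 = M (F z))
include h hM

lemma smul_generator_wirtinger (z : ℂ) : (w z : ℂ) • M (wirtinger F z) =
    wirtinger (fun z => (w z : ℂ)) z • wirtinger F z + ψ z • wirtingerBar F z -
      (w z : ℂ) ^ 2 • F z := by
  rw [← wirtinger_clm_apply M (h.differentiable z), funext (generator_apply hM),
    wirtinger_add (h.differentiable_wirtinger z) (h.differentiable_wirtingerBar z), smul_add,
    h.smul_wirtinger_wirtinger, h.wirtinger_wirtingerBar]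
  module

lemma smul_generator_wirtingerBar (z : ℂ) : (w z : ℂ) • M (wirtingerBar F z) =
    wirtingerBar (fun z => (w z : ℂ)) z • wirtingerBar F z - conj (ψ z) • wirtinger F z -
      (w z : ℂ) ^ 2 • F z := by
  have hx : wirtingerBar (fun z => M (F z)) z =
      wirtingerBar (wirtinger F) z + wirtingerBar (wirtingerBar F) z := by
    rw [funext (generator_apply hM), wirtingerBar_add (h.differentiable_wirtinger z)
      (h.differentiable_wirtingerBar z)]
  rw [← wirtingerBar_clm_apply M (h.differentiable z), hx, smul_add,
    h.smul_wirtingerBar_wirtingerBar, h.wirtingerBar_wirtinger]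
  module

lemma generator_comm {U : C3 ≃ₗᵢ[ℂ] C3} {σ : ℂ → ℂ} (hσ : ∀ (t : ℝ) z, σ (t + z) = t + σ z)
    (hU : ∀ z, F (σ z) = U (F z)) (v : C3) : M (U v) = U (M v) := by
  have hUx (z : ℂ) : fderiv ℝ F (σ z) 1 = U (fderiv ℝ F z 1) := by
    have key := ((U : C3 →L[ℂ] C3).restrictScalars ℝ).hasFDerivAt.comp_hasDerivAt 0
      (hasDerivAt_real_add h.differentiable z)
    refine (hasDerivAt_real_add h.differentiable (σ z)).unique ?_
    simp only [← hσ, hU]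
    exact key
  have key : M.comp (U : C3 →L[ℂ] C3) = (U : C3 →L[ℂ] C3).comp M :=
    h.clm_ext fun z => by simpa [hM, ← hU] using hUx z
  exact congr($key v)

end IsMinLagLift

section Eigenbasis

variable {K V ι : Type*} [Field K] [AddCommGroup V] [Module K V] {M : V →ₗ[K] V}
  {μ : ι → K}

lemma exists_eigenbasis [Fintype ι] [FiniteDimensional K V] (hμ : Function.Injective μ)
    (hM : M.charpoly = ∏ j, (Polynomial.X - Polynomial.C (μ j))) :
    ∃ B : Module.Basis ι K V, ∀ j, M (B j) = μ j • B j := by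
  have hroot (j : ι) : Module.End.HasEigenvalue M (μ j) := by
    rw [Module.End.hasEigenvalue_iff_isRoot_charpoly, hM, Polynomial.IsRoot.def,
      Polynomial.eval_prod]
    exact Finset.prod_eq_zero (Finset.mem_univ j) (by simp)
  choose v hv using fun j => (hroot j).exists_hasEigenvector
  have hcard : Fintype.card ι = Module.finrank K V := by
    rw [← M.charpoly_natDegree, hM, Polynomial.natDegree_finsetProd_X_sub_C_eq_card,
      Finset.card_univ]
  refine ⟨basisOfLinearIndependentOfCardEqFinrank'
    v (Module.End.eigenvectors_linearIndependent' M μ hμ v hv) hcard, fun j => ?_⟩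
  simpa using (hv j).apply_eq_smul

variable {B : Module.Basis ι K V} (hB : ∀ j, M (B j) = μ j • B j)
include hB

lemma eigenbasis_coord_apply (j : ι) (v : V) : B.coord j (M v) = μ j * B.coord j v := by
  classical
  have key : B.coord j ∘ₗ M = μ j • B.coord j := by
    refine B.ext fun i => ?_
    rcases eq_or_ne i j with rfl | hij
    · simp [hB]
    · simp [hB, hij.symm]
  exact congr($key v)

lemma eigenbasis_apply_of_comm (hμ : Function.Injective μ) {U : V →ₗ[K] V}
    (hU : ∀ v, M (U v) = U (M v)) (j : ι) : U (B j) = B.coord j (U (B j)) • B j := by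
  classical
  refine B.ext_elem fun i => ?_
  rcases eq_or_ne i j with rfl | hij
  · simp
  · have key := eigenbasis_coord_apply hB i (U (B j))
    rw [hU, hB, map_smul, map_smul, smul_eq_mul] at key
    have hzero : B.coord i (U (B j)) = 0 := by
      have hsub : μ j - μ i ≠ 0 := sub_ne_zero.2 (hμ.ne hij.symm)
      exact (mul_eq_zero.1 (by linear_combination key : (μ j - μ i) * _ = 0)).resolve_left hsub
    simpa [hij.symm] using hzero

lemma eigenbasis_comm (hμ : Function.Injective μ) {U U' : V →ₗ[K] V}
    (hU : ∀ v, M (U v) = U (M v)) (hU' : ∀ v, M (U' v) = U' (M v)) (v : V) :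
    U (U' v) = U' (U v) := by
  have key : U ∘ₗ U' = U' ∘ₗ U := B.ext fun j => by
    have hj := eigenbasis_apply_of_comm hB hμ hU j
    have hj' := eigenbasis_apply_of_comm hB hμ hU' j
    generalize B.coord j (U (B j)) = c at hj
    generalize B.coord j (U' (B j)) = c' at hj'
    rw [LinearMap.comp_apply, LinearMap.comp_apply, hj, hj', map_smul, map_smul, hj, hj', smul_comm]
  exact congr($key v)

end Eigenbasis

lemma exists_circle_coord_eq {V ι : Type*} [NormedAddCommGroup V] [NormedSpace ℂ V]
    {M : V →ₗ[ℂ] V} {μ : ι → ℂ} {B : Module.Basis ι ℂ V} (hB : ∀ j, M (B j) = μ j • B j)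
    (hμ : Function.Injective μ) {U : V →ₗᵢ[ℂ] V} (hU : ∀ v, M (U v) = U (M v)) :
    ∃ ε : ι → Circle, ∀ j v, B.coord j (U v) = ε j * B.coord j v := by
  have hdiag := eigenbasis_apply_of_comm hB hμ (U := U.toLinearMap) hU
  have hnorm (j : ι) : ‖B.coord j (U (B j))‖ = 1 := by
    have key := congr(‖$(hdiag j)‖)
    rw [norm_smul, LinearIsometry.coe_toLinearMap, U.norm_map] at key
    exact mul_right_cancel₀ (norm_ne_zero_iff.2 (B.ne_zero j)) (key.symm.trans (one_mul _).symm)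
  refine ⟨fun j => ⟨_, mem_sphere_zero_iff_norm.2 (hnorm j)⟩, fun j v => ?_⟩
  have key : B.coord j ∘ₗ U.toLinearMap = B.coord j (U (B j)) • B.coord j := by
    classical
    refine B.ext fun i => ?_
    rw [LinearMap.comp_apply, hdiag]
    rcases eq_or_ne i j with rfl | hij
    · simp
    · simp [hij.symm]
  exact congr($key v)

lemma ofReal_exp_half_sq (x : ℝ) : (Real.exp (x / 2) : ℂ) ^ 2 = Real.exp x := by
  rw [← Complex.ofReal_pow, ← Real.exp_nat_mul, Nat.cast_ofNat, mul_div_cancel₀ _ two_ne_zero]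

namespace IsMinLagLift

variable {F : ℂ → C3} {w : ℂ → ℝ} {ψ : ℂ → ℂ} (h : IsMinLagLift F w ψ) {M : C3 →L[ℂ] C3}
  (hM : ∀ z, fderiv ℝ F z 1 = M (F z)) {lam ψ₀ z : ℂ} {u₀ : ℝ}
include h hM

lemma generator_wirtinger_of_critical (hdw : wirtinger (fun z => (w z : ℂ)) z = 0) :
    M (wirtinger F z) = (ψ z / w z) • wirtingerBar F z - (w z : ℂ) • F z := by
  have hw := h.metric_ne_zero z
  rw [← inv_smul_smul₀ hw (M (wirtinger F z)), h.smul_generator_wirtinger hM, hdw]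
  match_scalars <;> field_simp
  ring

lemma generator_wirtingerBar_of_critical (hdw : wirtinger (fun z => (w z : ℂ)) z = 0) :
    M (wirtingerBar F z) = -(conj (ψ z) / w z) • wirtinger F z - (w z : ℂ) • F z := by
  have hw := h.metric_ne_zero z
  have hdw' : wirtingerBar (fun z => (w z : ℂ)) z = 0 := by
    rw [← map_eq_zero (starRingEnd ℂ), h.conj_wirtingerBar_metric, hdw]
  rw [← inv_smul_smul₀ hw (M (wirtingerBar F z)), h.smul_generator_wirtingerBar hM, hdw']
  match_scalars <;> field_simp
  ring

lemma toMatrix_generator (hlam : ‖lam‖ = 1) (hw : w z = Real.exp u₀)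
    (hdw : wirtinger (fun z => (w z : ℂ)) z = 0) (hψ : ψ z = -Complex.I * lam⁻¹ ^ 3 * ψ₀) :
    LinearMap.toMatrix (h.frame hlam z).toBasis (h.frame hlam z).toBasis M.toLinearMap =
      potential ψ₀ u₀ lam := by
  have hlam0 : lam ≠ 0 := norm_ne_zero_iff.1 (by simp [hlam])
  have hconj : conj lam = lam⁻¹ := (Complex.inv_eq_conj hlam).symm
  have hs0 : (Real.exp (u₀ / 2) : ℂ) ≠ 0 := Complex.ofReal_ne_zero.2 (Real.exp_ne_zero _)
  have hsq : (Real.exp (u₀ / 2) : ℂ) ^ 2 = w z := by rw [ofReal_exp_half_sq, hw]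
  have hneg : (Real.exp (-u₀) : ℂ) = (w z : ℂ)⁻¹ := by rw [hw, Real.exp_neg, Complex.ofReal_inv]
  have hsqrt : √(w z) = Real.exp (u₀ / 2) := by rw [hw, Real.exp_half]
  have hP := h.generator_wirtinger_of_critical hM hdw
  have hQ := h.generator_wirtingerBar_of_critical hM hdw
  let b := (h.frame hlam z).toBasis
  apply (LinearMap.toMatrix b b).symm.injective
  rw [LinearEquiv.symm_apply_apply]
  refine b.ext fun j => ?_
  rw [LinearMap.toMatrix_symm, Matrix.toLin_self, Fin.sum_univ_three]
  simp only [b, OrthonormalBasis.coe_toBasis, coe_frame, potential, hneg, hsqrt]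
  generalize (Real.exp (u₀ / 2) : ℂ) = s at hs0 hsq
  rw [← hsq] at hP hQ ⊢
  fin_cases j
  · simp only [neg_mul, Fin.zero_eta, Matrix.cons_val_zero, map_smul,
      ContinuousLinearMap.coe_coe, hP, hψ, Matrix.of_apply,
      Matrix.cons_val', Matrix.cons_val_fin_one, Matrix.cons_val_one, Matrix.cons_val,
      zero_smul, zero_add]
    match_scalars <;> field_simp
  · simp only [neg_mul, Fin.mk_one, Matrix.cons_val_one, Matrix.cons_val_zero, map_smul,
      ContinuousLinearMap.coe_coe, hQ, hψ, map_neg, map_mul, Complex.conj_I,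
      map_inv₀, map_pow, hconj, inv_inv, Matrix.of_apply, Matrix.cons_val',
      Matrix.cons_val_fin_one, Matrix.cons_val, zero_smul, add_zero]
    match_scalars <;> field_simp
  · simp only [neg_mul, Fin.reduceFinMk, Matrix.cons_val, ContinuousLinearMap.coe_coe,
      generator_apply hM, Matrix.of_apply, Matrix.cons_val', Matrix.cons_val_fin_one,
      Matrix.cons_val_zero, Matrix.cons_val_one]
    match_scalars <;> field_simp <;> linear_combination Complex.I_sq

end IsMinLagLift

/-! ### Eigencoordinates of the lift -/

lemma eq_exp_integral_of_deriv_eq_mul {g q : ℝ → ℂ} (hq : Continuous q)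
    (hg : ∀ y, HasDerivAt g (q y * g y) y) (s t : ℝ) :
    g t = Complex.exp (∫ y in s..t, q y) * g s := by
  have hint (y : ℝ) : HasDerivAt (fun y => ∫ x in s..y, q x) (q y) y :=
    (hq.integral_hasStrictDerivAt s y).hasDerivAt
  have hder (y : ℝ) : HasDerivAt (fun y => Complex.exp (-∫ x in s..y, q x) * g y) 0 y :=
    ((hint y).fun_neg.cexp.fun_mul (hg y)).congr_deriv (by ring)
  have key := is_const_of_deriv_eq_zero (fun y => (hder y).differentiableAt)
    (fun y => (hder y).deriv) t s
  simp only [intervalIntegral.integral_same, neg_zero, Complex.exp_zero, one_mul] at key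
  rw [← key, ← mul_assoc, ← Complex.exp_add, add_neg_cancel, Complex.exp_zero, one_mul]

lemma circle_eq_exp_im {ε : Circle} {z : ℂ} (h : (ε : ℂ) = Complex.exp z) :
    ε = Circle.exp z.im := by
  have hre : z.re = 0 := by
    rw [← Real.exp_eq_one_iff, ← Complex.norm_exp, ← h, Circle.norm_coe]
  ext
  rw [h, Circle.coe_exp]
  congr 1
  apply Complex.ext <;> simp [hre]

section Eigencoordinate

variable {F : ℂ → C3} {M : C3 →L[ℂ] C3} (hM : ∀ z, fderiv ℝ F z 1 = M (F z)) {L : C3 →L[ℂ] ℂ}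
  {d : ℝ} (hL : ∀ v, L (M v) = Complex.I * d * L v)
include hM hL

lemma eigencoord_add_real (hF : Differentiable ℝ F) (x : ℝ) (z : ℂ) :
    L (F (x + z)) = Circle.exp (d * x) * L (F z) := by
  have hder (x : ℝ) : HasDerivAt (fun x : ℝ => L (F (x + z)))
      (Complex.I * d * L (F (x + z))) x := by
    have hline := hasDerivAt_comp_line hF z 1 x
    simp only [mul_one, add_comm z] at hline
    rw [← hL, ← hM]
    exact (L.restrictScalars ℝ).hasFDerivAt.comp_hasDerivAt x hline
  have key := eq_exp_integral_of_deriv_eq_mul continuous_const hder 0 x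
  simp only [intervalIntegral.integral_const, Complex.ofReal_zero, zero_add] at key
  rw [key, Circle.coe_exp]
  congr 2
  rw [Complex.real_smul]
  push_cast
  ring

end Eigencoordinate

/-- The phase by which the period `τ` of the metric rotates the eigencoordinate of the eigenvalue
`i d`, for a Hopf differential `ψ` with nonzero real part. -/
noncomputable def phase (w : ℝ → ℝ) (ψ : ℂ) (τ d : ℝ) : ℝ :=
  ∫ y in (0 : ℝ)..τ, ψ.re * (d ^ 2 * w y - ψ.im * d - 2 * w y ^ 2) / (deriv w y ^ 2 / 4 + ψ.re ^ 2)

lemma im_intervalIntegral_div {N D : ℝ → ℝ} {b : ℝ} (hN : Continuous N) (hD : Continuous D)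
    (hb : b ≠ 0) (s t : ℝ) : (∫ y in s..t, (N y / (D y - b * Complex.I) : ℂ)).im =
      ∫ y in s..t, b * N y / (D y ^ 2 + b ^ 2) := by
  have hden (y : ℝ) : (D y - b * Complex.I : ℂ) ≠ 0 := fun h0 =>
    hb (by simpa using congr(Complex.im $h0))
  have hint : Continuous fun y => (N y / (D y - b * Complex.I) : ℂ) :=
    Continuous.div (by fun_prop) (by fun_prop) hden
  rw [← Complex.imCLM_apply, ← Complex.imCLM.intervalIntegral_comp_comm
    (hint.intervalIntegrable s t)]
  congr with y
  have hnorm : Complex.normSq (D y - b * Complex.I) = D y ^ 2 + b ^ 2 := by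
    simp [Complex.normSq_apply, sq]
  rw [Complex.imCLM_apply, Complex.div_im, hnorm]
  simp only [Complex.ofReal_im, Complex.ofReal_re, Complex.sub_re, Complex.sub_im, Complex.mul_re,
    Complex.mul_im, Complex.I_re, Complex.I_im]
  ring

namespace IsMinLagLift

variable {F : ℂ → C3} {w : ℝ → ℝ} {ψ : ℂ} (h : IsMinLagLift F (fun z => w z.im) fun _ => ψ)
include h

lemma contDiff_profile : ContDiff ℝ ∞ w := by
  have key := h.contDiff_metric.comp
    (Complex.ofRealCLM.contDiff.mul (contDiff_const (c := Complex.I)))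
  simpa [Function.comp_def] using key

lemma hasDerivAt_profile (y : ℝ) : HasDerivAt w (deriv w y) y :=
  (h.contDiff_profile.differentiable (by simp) y).hasDerivAt

lemma wirtinger_profile (z : ℂ) :
    wirtinger (fun z => (w z.im : ℂ)) z = -(Complex.I / 2) * deriv w z.im := by
  rw [wirtinger_comp_im (h.hasDerivAt_profile z.im).ofReal_comp, smul_eq_mul]

lemma wirtingerBar_profile (z : ℂ) :
    wirtingerBar (fun z => (w z.im : ℂ)) z = Complex.I / 2 * deriv w z.im := by
  rw [wirtingerBar_comp_im (h.hasDerivAt_profile z.im).ofReal_comp, smul_eq_mul]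

variable {M : C3 →L[ℂ] C3} (hM : ∀ z, fderiv ℝ F z 1 = M (F z)) {L : C3 →L[ℂ] ℂ}
  {d : ℝ} (hL : ∀ v, L (M v) = Complex.I * d * L v)
include hM hL

lemma eigencoord_fderiv_I (z : ℂ) :
    (deriv w z.im / 2 - ψ.re * Complex.I) * L (fderiv ℝ F z Complex.I) =
      (d ^ 2 * w z.im - ψ.im * d - 2 * w z.im ^ 2 : ℝ) * L (F z) := by
  have hx := congr(L $(generator_apply hM z))
  have hy := congr(L $(I_smul_wirtinger_sub_wirtingerBar F z))
  have hP := congr(L $(h.smul_generator_wirtinger hM z))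
  have hQ := congr(L $(h.smul_generator_wirtingerBar hM z))
  simp only [map_smul, map_sub, map_add, hL, h.wirtinger_profile, h.wirtingerBar_profile,
    smul_eq_mul] at hx hy hP hQ
  have hψ : ψ = ψ.re + ψ.im * Complex.I := (Complex.re_add_im ψ).symm
  have hψ' : conj ψ = ψ.re - ψ.im * Complex.I := by
    apply Complex.ext <;> simp
  rw [hψ'] at hQ
  nth_rw 1 [hψ] at hP
  rw [← hy]
  push_cast
  linear_combination hP + hQ + (Complex.I * d * w z.im - ψ.im * Complex.I) * hx +
    ((ψ.im * d - w z.im * d ^ 2) * L (F z) -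
      ψ.re * (L (wirtinger F z) - L (wirtingerBar F z))) * Complex.I_sq

omit hM hL in
lemma continuous_deriv_profile : Continuous (deriv w) :=
  h.contDiff_profile.continuous_deriv (by simp)

lemma eigencoord_vertical (hre : ψ.re ≠ 0) (y : ℝ) :
    L (F (y * Complex.I)) = Complex.exp (∫ t in (0 : ℝ)..y,
      (d ^ 2 * w t - ψ.im * d - 2 * w t ^ 2 : ℝ) / (deriv w t / 2 - ψ.re * Complex.I)) *
        L (F 0) := by
  have hden (t : ℝ) : (deriv w t / 2 - ψ.re * Complex.I : ℂ) ≠ 0 := fun h0 =>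
    hre (by simpa using congr(Complex.im $h0))
  have hw := h.contDiff_profile.continuous
  have hw' := h.continuous_deriv_profile
  have hder (t : ℝ) : HasDerivAt (fun t : ℝ => L (F (t * Complex.I)))
      ((d ^ 2 * w t - ψ.im * d - 2 * w t ^ 2 : ℝ) / (deriv w t / 2 - ψ.re * Complex.I) *
        L (F (t * Complex.I))) t := by
    have hline := hasDerivAt_comp_line h.differentiable 0 Complex.I t
    simp only [zero_add] at hline
    have key := h.eigencoord_fderiv_I hM hL (t * Complex.I)
    simp only [Complex.im_ofReal_mul, Complex.I_im, mul_one] at key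
    rw [div_mul_eq_mul_div, ← key, mul_div_cancel_left₀ _ (hden t)]
    exact (L.restrictScalars ℝ).hasFDerivAt.comp_hasDerivAt t hline
  have key := eq_exp_integral_of_deriv_eq_mul (Continuous.div (by fun_prop) (by fun_prop) hden)
    hder 0 y
  simpa only [Pi.div_apply, Complex.ofReal_zero, zero_mul] using key

lemma eigencoord_zero_ne_zero (hre : ψ.re ≠ 0) (hL0 : L ≠ 0) : L (F 0) ≠ 0 := fun h0 =>
  hL0 (h.clm_ext fun z => by
    rw [← Complex.re_add_im z, eigencoord_add_real hM hL h.differentiable,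
      h.eigencoord_vertical hM hL hre, h0]
    simp)

lemma multiplier_eq_exp_phase (hre : ψ.re ≠ 0) (hL0 : L ≠ 0) {ε : Circle} {τ : ℝ}
    (hε : L (F (τ * Complex.I)) = ε * L (F 0)) : ε = Circle.exp (phase w ψ τ d) := by
  have hw := h.contDiff_profile.continuous
  have hw' := h.continuous_deriv_profile
  rw [h.eigencoord_vertical hM hL hre] at hε
  rw [circle_eq_exp_im (mul_right_cancel₀ (h.eigencoord_zero_ne_zero hM hL hre hL0) hε).symm]
  congr 1
  have key := im_intervalIntegral_div (N := fun y => d ^ 2 * w y - ψ.im * d - 2 * w y ^ 2)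
    (D := fun y => deriv w y / 2) (by fun_prop) (by fun_prop) hre 0 τ
  push_cast at key ⊢
  rw [key, phase]
  congr with y
  ring

end IsMinLagLift

/-! ### Periods of the surface -/

lemma injective_I_mul_ofReal {ι : Type*} {d : ι → ℝ} (hd : Function.Injective d) :
    Function.Injective fun j => Complex.I * (d j : ℂ) :=
  (mul_right_injective₀ Complex.I_ne_zero).comp (Complex.ofReal_injective.comp hd)

/-- Translation by `v` multiplies the coordinates of `F` in the basis `B` by the unit numbers
`ε j`. For an eigenbasis of the generator, this diagonalises the periods of `F`. -/
def HasMultipliers {ι : Type*} (B : Module.Basis ι ℂ C3) (F : ℂ → C3) (v : ℂ) (ε : ι → Circle) :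
    Prop :=
  ∀ j z, B.coord j (F (v + z)) = ε j * B.coord j (F z)

namespace HasMultipliers

variable {ι : Type*} {B : Module.Basis ι ℂ C3} {F : ℂ → C3} {v v' : ℂ} {ε ε' : ι → Circle}

lemma add (h : HasMultipliers B F v ε) (h' : HasMultipliers B F v' ε') :
    HasMultipliers B F (v + v') (ε * ε') := fun j z => by
  rw [add_assoc, h, h', Pi.mul_apply, Circle.coe_mul, mul_assoc]

lemma neg (h : HasMultipliers B F v ε) : HasMultipliers B F (-v) ε⁻¹ := fun j z => by
  have key := h j (-v + z)
  rw [add_neg_cancel_left] at key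
  rw [key, ← mul_assoc, ← Circle.coe_mul, Pi.inv_apply, inv_mul_cancel, Circle.coe_one, one_mul]

lemma zsmul (h : HasMultipliers B F v ε) (n : ℤ) : HasMultipliers B F (n • v) (ε ^ n) := by
  have hnat (n : ℕ) : HasMultipliers B F (n • v) (ε ^ n) := by
    induction n with
    | zero => intro j z; simp
    | succ n ih => simpa only [succ_nsmul, pow_succ] using ih.add h
  cases n with
  | ofNat n => simpa using hnat n
  | negSucc n => simpa only [negSucc_zsmul, zpow_negSucc] using (hnat (n + 1)).neg

lemma exists_eq_smul_iff [Nonempty ι] {w : ℂ → ℝ} {ψ : ℂ → ℂ} (hF : IsMinLagLift F w ψ)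
    (h : HasMultipliers B F v ε) :
    (∃ c : ℂ, ‖c‖ = 1 ∧ ∀ z, F (v + z) = c • F z) ↔ ∀ i j, ε i = ε j := by
  constructor
  · rintro ⟨c, -, hc⟩
    have hε (j : ι) : (ε j : ℂ) = c := by
      obtain ⟨z, hz⟩ : ∃ z, B.coord j (F z) ≠ 0 := by
        by_contra! hzero
        have hL : LinearMap.toContinuousLinearMap (B.coord j) = 0 := hF.clm_ext hzero
        simpa using congr($hL (B j))
      apply mul_right_cancel₀ hz
      rw [← h j z, hc, map_smul, smul_eq_mul]
    exact fun i j => Circle.coe_injective ((hε i).trans (hε j).symm)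
  · intro hε
    obtain ⟨i⟩ := ‹Nonempty ι›
    refine ⟨ε i, Circle.norm_coe _, fun z => B.ext_elem fun j => ?_⟩
    rw [map_smul, Finsupp.smul_apply, smul_eq_mul, hε i j]
    exact h j z

end HasMultipliers

namespace IsMinLagLift

variable {F : ℂ → C3} {w : ℝ → ℝ} {ψ : ℂ} (h : IsMinLagLift F (fun z => w z.im) fun _ => ψ)
  {M : C3 →L[ℂ] C3} (hM : ∀ z, fderiv ℝ F z 1 = M (F z)) {τ : ℝ}

include h in
lemma exists_translation (hτ : ∀ y, w (τ + y) = w y) :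
    ∃ U : C3 ≃ₗᵢ[ℂ] C3, ∀ z, F (τ * Complex.I + z) = U (F z) :=
  ⟨_, fun z => (h.transport_apply_self (h.translation_eq (c := τ * Complex.I) (by simp [hτ]))
    0 z).symm⟩

include h in
lemma exists_reflection (hre : ψ.re = 0) (heven : ∀ y, w (-y) = w y) :
    ∃ U : C3 ≃ₗᵢ[ℂ] C3, ∀ z, F (conj z) = U (F z) := by
  have hψ : -conj ψ = ψ := by apply Complex.ext <;> simp [hre]
  have h' : IsMinLagLift (fun z => F (conj z)) (fun z => w z.im) fun _ => ψ := by
    simpa only [Complex.conj_im, heven, hψ] using h.comp_conj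
  exact ⟨_, fun z => (h.transport_apply_self h' 0 z).symm⟩

variable {ι : Type*} {d : ι → ℝ} {B : Module.Basis ι ℂ C3}
  (hB : ∀ j, M (B j) = (Complex.I * d j) • B j)
include h hM hB

lemma hasMultipliers_real (x : ℝ) : HasMultipliers B F x fun j => Circle.exp (d j * x) :=
  fun j z => eigencoord_add_real hM (L := LinearMap.toContinuousLinearMap (B.coord j))
    (eigenbasis_coord_apply (M := M.toLinearMap) hB j) h.differentiable x z

variable (hd : Function.Injective d) (hτ : ∀ y, w (τ + y) = w y)
include hd hτ

lemma exists_hasMultipliers_vertical : ∃ ε : ι → Circle, HasMultipliers B F (τ * Complex.I) ε := by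
  obtain ⟨U, hU⟩ := h.exists_translation hτ
  obtain ⟨ε, hε⟩ := exists_circle_coord_eq (M := M.toLinearMap) hB (injective_I_mul_ofReal hd)
    (U := U.toLinearIsometry) (h.generator_comm hM (fun _ _ => add_left_comm _ _ _) hU)
  exact ⟨ε, fun j z => by rw [hU]; exact hε j (F z)⟩

lemma hasMultipliers_vertical (hre : ψ.re ≠ 0) :
    HasMultipliers B F (τ * Complex.I) fun j => Circle.exp (phase w ψ τ (d j)) := by
  obtain ⟨ε, hε⟩ := h.exists_hasMultipliers_vertical hM hB hd hτ
  convert hε using 2 with j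
  have hL0 : LinearMap.toContinuousLinearMap (B.coord j) ≠ 0 := fun h0 => by
    simpa using congr($h0 (B j))
  refine (h.multiplier_eq_exp_phase hM (eigenbasis_coord_apply (M := M.toLinearMap) hB j) hre hL0
    ?_).symm
  simpa using hε j 0

/-- `z ↦ z̄` conjugates the translation by `τ i` to its inverse, and it commutes with it because
both act diagonally on the eigenbasis. -/
lemma hasMultipliers_two_vertical (hre : ψ.re = 0) (heven : ∀ y, w (-y) = w y) :
    HasMultipliers B F (2 * τ * Complex.I) 1 := by
  obtain ⟨U, hU⟩ := h.exists_translation hτ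
  obtain ⟨V, hV⟩ := h.exists_reflection hre heven
  have hUV := eigenbasis_comm (M := M.toLinearMap) (U := U.toLinearMap) (U' := V.toLinearMap) hB
    (injective_I_mul_ofReal hd) (h.generator_comm hM (fun _ _ => add_left_comm _ _ _) hU)
    (h.generator_comm hM (by simp) hV)
  have hinv (z : ℂ) : F (-(τ * Complex.I) + z) = F (τ * Complex.I + z) := by
    calc F (-(τ * Complex.I) + z) = F (conj (τ * Complex.I + conj z)) := by simp
      _ = V (U (F (conj z))) := by rw [hV, hU]
      _ = U (V (F (conj z))) := (hUV _).symm
      _ = F (τ * Complex.I + z) := by rw [← hV, Complex.conj_conj, hU]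
  intro j z
  rw [Pi.one_apply, Circle.coe_one, one_mul, two_mul, add_mul, add_assoc, ← hinv,
    neg_add_cancel_left]

end IsMinLagLift

lemma descendsToTorus_iff_of_im {f : ℂ → CP2} {τ : ℝ}
    (hτ : ∀ v, Function.Periodic f v → ∃ n : ℤ, v.im = n * τ) :
    DescendsToTorus f ↔ (∃ s : ℝ, s ≠ 0 ∧ Function.Periodic f s) ∧
      ∃ v : ℂ, v.im ≠ 0 ∧ Function.Periodic f v := by
  constructor
  · rintro ⟨v₁, v₂, hli, (hp₁ : Function.Periodic f v₁), (hp₂ : Function.Periodic f v₂)⟩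
    obtain ⟨n₁, hn₁⟩ := hτ v₁ hp₁
    obtain ⟨n₂, hn₂⟩ := hτ v₂ hp₂
    rw [LinearIndependent.pair_iff] at hli
    have him : v₁.im ≠ 0 ∨ v₂.im ≠ 0 := by
      by_contra! him
      have hre := hli v₂.re (-v₁.re) (by apply Complex.ext <;> simp [him]; ring)
      have hone := hli 1 0 (by apply Complex.ext <;> simp [him, neg_eq_zero.1 hre.2])
      exact one_ne_zero hone.1
    have hreal : n₂ • v₁ - n₁ • v₂ = ((n₂ * v₁.re - n₁ * v₂.re : ℝ) : ℂ) := by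
      apply Complex.ext
      · simp
      · simp [hn₁, hn₂, mul_left_comm]
    refine ⟨⟨n₂ * v₁.re - n₁ * v₂.re, fun h0 => ?_, hreal ▸ (hp₁.zsmul n₂).sub_period
      (hp₂.zsmul n₁)⟩, him.elim (fun h => ⟨v₁, h, hp₁⟩) fun h => ⟨v₂, h, hp₂⟩⟩
    rw [h0, Complex.ofReal_zero] at hreal
    have hn := hli n₂ (-n₁) (by
      simpa [sub_eq_add_neg] using hreal)
    rw [neg_eq_zero] at hn
    rw [hn₁, hn₂, hn.1, hn.2] at him
    simp at him
  · rintro ⟨⟨s, hs, hps⟩, v, hv, hpv⟩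
    refine ⟨s, v, LinearIndependent.pair_iff.2 fun a b hab => ?_, hps, hpv⟩
    have hb : b = 0 := by simpa [hv] using congr(Complex.im $hab)
    have ha : a = 0 := by simpa [hb, hs] using congr(Complex.re $hab)
    exact ⟨ha, hb⟩

lemma IsMinLagLift.metric_add_of_periodic {f : ℂ → CP2} {F : ℂ → C3} {w : ℂ → ℝ} {ψ : ℂ → ℂ}
    (h : IsMinLagLift F w ψ) (hF : IsHorizontalLift f F) {v : ℂ} (hv : Function.Periodic f v)
    (z : ℂ) : w (v + z) = w z := by
  obtain ⟨c, hc, hcF⟩ := (hF.period_iff v).1 hv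
  have hP : wirtinger F (v + z) = c • wirtinger F z := by
    rw [← wirtinger_comp_const_add, funext hcF]
    exact wirtinger_clm_apply (c • ContinuousLinearMap.id ℂ C3) (h.differentiable z)
  rw [← h.norm_sq_wirtinger, ← h.norm_sq_wirtinger, hP, norm_smul, hc, one_mul]

namespace IsMinLagLift

variable {f : ℂ → CP2} {F : ℂ → C3} {w : ℝ → ℝ} {ψ : ℂ}
  (h : IsMinLagLift F (fun z => w z.im) fun _ => ψ) (hF : IsHorizontalLift f F)
  {τ : ℝ} (hτ0 : τ ≠ 0) (hτ : ∀ y, w (τ + y) = w y)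
  (hmin : ∀ y, w y = w 0 → ∃ n : ℤ, y = n * τ)
  {M : C3 →L[ℂ] C3} (hM : ∀ z, fderiv ℝ F z 1 = M (F z)) {ι : Type*} [Nonempty ι]
  {d : ι → ℝ} {B : Module.Basis ι ℂ C3} (hB : ∀ j, M (B j) = (Complex.I * d j) • B j)
  (hd : Function.Injective d)

include h hF hM hB in
lemma periodic_ofReal_iff (s : ℝ) :
    Function.Periodic f s ↔ ∀ i j, Circle.exp (d i * s) = Circle.exp (d j * s) :=
  (hF.period_iff s).trans ((h.hasMultipliers_real hM hB s).exists_eq_smul_iff h)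

include h hF hmin

lemma descendsToTorus_iff_periodic :
    DescendsToTorus f ↔ (∃ s : ℝ, s ≠ 0 ∧ Function.Periodic f s) ∧
      ∃ v : ℂ, v.im ≠ 0 ∧ Function.Periodic f v :=
  descendsToTorus_iff_of_im fun v hv => hmin _ (by
    simpa using h.metric_add_of_periodic hF hv 0)

include hM hB hτ0 hτ hd

lemma descendsToTorus_iff_of_re_eq_zero (heven : ∀ y, w (-y) = w y) (hre : ψ.re = 0) :
    DescendsToTorus f ↔ ∃ s ≠ 0, ∀ i j, Circle.exp (d i * s) = Circle.exp (d j * s) := by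
  rw [h.descendsToTorus_iff_periodic hF hmin]
  simp only [h.periodic_ofReal_iff hF hM hB]
  refine and_iff_left ⟨2 * τ * Complex.I, by simpa using hτ0, (hF.period_iff _).2 ?_⟩
  rw [(h.hasMultipliers_two_vertical hM hB hd hτ hre heven).exists_eq_smul_iff h]
  exact fun _ _ => rfl

lemma descendsToTorus_iff_of_re_ne_zero (hre : ψ.re ≠ 0) : DescendsToTorus f ↔
    (∃ s ≠ 0, ∀ i j, Circle.exp (d i * s) = Circle.exp (d j * s)) ∧
      ∃ s : ℝ, ∃ n : ℤ, n ≠ 0 ∧ ∀ i j, Circle.exp (d i * s + n * phase w ψ τ (d i)) =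
        Circle.exp (d j * s + n * phase w ψ τ (d j)) := by
  have hmul (s : ℝ) (n : ℤ) : Function.Periodic f (s + n • (τ * Complex.I)) ↔
      ∀ i j, Circle.exp (d i * s + n * phase w ψ τ (d i)) =
        Circle.exp (d j * s + n * phase w ψ τ (d j)) := by
    have key := (h.hasMultipliers_real hM hB s).add
      ((h.hasMultipliers_vertical hM hB hd hτ hre).zsmul n)
    refine (hF.period_iff _).trans ((key.exists_eq_smul_iff h).trans ?_)
    simp only [Pi.mul_apply, Pi.pow_apply, Circle.exp_add, ← zsmul_eq_mul, Circle.exp_zsmul]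
  rw [h.descendsToTorus_iff_periodic hF hmin]
  simp only [h.periodic_ofReal_iff hF hM hB, ← hmul]
  refine and_congr_right fun _ => ⟨fun ⟨v, hv0, hv⟩ => ?_, fun ⟨s, n, hn, hs⟩ =>
    ⟨_, by simpa using ⟨hn, hτ0⟩, hs⟩⟩
  obtain ⟨n, hn⟩ := hmin v.im (by simpa using h.metric_add_of_periodic hF hv 0)
  refine ⟨v.re, n, fun h0 => hv0 (by simp [hn, h0]), ?_⟩
  rwa [zsmul_eq_mul, ← mul_assoc, ← Complex.ofReal_intCast, ← Complex.ofReal_mul, ← hn,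
    Complex.re_add_im]

end IsMinLagLift

/-! ### Legendre's integral of the first kind and the Jacobi amplitude -/

/-- The incomplete elliptic integral of the first kind `F(φ | m)`, with parameter `m = k²`. -/
noncomputable def ellipticF (m φ : ℝ) : ℝ := ∫ t in (0 : ℝ)..φ, 1 / √(1 - m * Real.sin t ^ 2)

/-- The Jacobi amplitude `am(u | m)`, the inverse function of `ellipticF m` for `m < 1`. -/
noncomputable def jacobiAm (m : ℝ) : ℝ → ℝ := Function.invFun (ellipticF m)

section Elliptic

variable {m : ℝ} (hm : m < 1)

include hm in
lemma one_sub_mul_sin_sq_pos (t : ℝ) : 0 < 1 - m * Real.sin t ^ 2 := by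
  rcases le_or_gt m 0 with h0 | h0
  · nlinarith [sq_nonneg (Real.sin t)]
  · nlinarith [Real.sin_sq_le_one t]

include hm in
lemma continuous_ellipticF_integrand : Continuous fun t => 1 / √(1 - m * Real.sin t ^ 2) :=
  continuous_const.div (by fun_prop) fun t => (Real.sqrt_pos.2 (one_sub_mul_sin_sq_pos hm t)).ne'

include hm in
lemma intervalIntegrable_ellipticF_integrand (a b : ℝ) :
    IntervalIntegrable (fun t => 1 / √(1 - m * Real.sin t ^ 2)) MeasureTheory.volume a b :=
  (continuous_ellipticF_integrand hm).intervalIntegrable a b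

lemma periodic_ellipticF_integrand (m : ℝ) :
    Function.Periodic (fun t => 1 / √(1 - m * Real.sin t ^ 2)) Real.pi := fun t => by
  simp only [Real.sin_add_pi, neg_sq]

lemma ellipticF_neg (m φ : ℝ) : ellipticF m (-φ) = -ellipticF m φ := by
  have hneg := intervalIntegral.integral_comp_neg (a := 0) (b := φ)
    fun t => 1 / √(1 - m * Real.sin t ^ 2)
  simp only [Real.sin_neg, neg_sq, neg_zero] at hneg
  rw [ellipticF, intervalIntegral.integral_symm, ← hneg, ellipticF]

include hm

lemma hasDerivAt_ellipticF (φ : ℝ) :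
    HasDerivAt (ellipticF m) (1 / √(1 - m * Real.sin φ ^ 2)) φ :=
  ((continuous_ellipticF_integrand hm).integral_hasStrictDerivAt 0 φ).hasDerivAt

lemma ellipticF_strictMono : StrictMono (ellipticF m) :=
  strictMono_of_deriv_pos fun φ => by
    rw [(hasDerivAt_ellipticF hm φ).deriv]
    exact one_div_pos.2 (Real.sqrt_pos.2 (one_sub_mul_sin_sq_pos hm φ))

lemma ellipticF_surjective : Function.Surjective (ellipticF m) := by
  have hint := intervalIntegrable_ellipticF_integrand hm
  have hpos (t : ℝ) : 0 < 1 / √(1 - m * Real.sin t ^ 2) :=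
    one_div_pos.2 (Real.sqrt_pos.2 (one_sub_mul_sin_sq_pos hm t))
  have hcont : Continuous (ellipticF m) :=
    continuous_iff_continuousAt.2 fun φ => (hasDerivAt_ellipticF hm φ).continuousAt
  have hper := periodic_ellipticF_integrand m
  exact hcont.surjective (hper.tendsto_atTop_intervalIntegral_of_pos' (hint _ _) hpos Real.pi_pos)
    (hper.tendsto_atBot_intervalIntegral_of_pos' (hint _ _) hpos Real.pi_pos)

lemma ellipticF_pi : ellipticF m Real.pi = 2 * ellipticK m := by
  have hint := intervalIntegrable_ellipticF_integrand hm
  have hreflect := intervalIntegral.integral_comp_sub_left (a := 0) (b := Real.pi / 2)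
    (fun t => 1 / √(1 - m * Real.sin t ^ 2)) Real.pi
  simp only [Real.sin_pi_sub, sub_zero, sub_half] at hreflect
  rw [ellipticF, ← intervalIntegral.integral_add_adjacent_intervals (hint 0 (Real.pi / 2))
    (hint (Real.pi / 2) Real.pi), ← hreflect, ellipticK, two_mul]

lemma ellipticK_pos : 0 < ellipticK m := by
  have hlt := ellipticF_strictMono hm Real.pi_pos
  rw [ellipticF_pi hm, ellipticF, intervalIntegral.integral_same] at hlt
  linarith

lemma ellipticF_add_int_mul_pi (φ : ℝ) (n : ℤ) :
    ellipticF m (φ + n * Real.pi) = ellipticF m φ + n * (2 * ellipticK m) := by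
  have hint := intervalIntegrable_ellipticF_integrand hm
  have hper := periodic_ellipticF_integrand m
  have hn := hper.intervalIntegral_add_zsmul_eq n φ hint
  rw [hper.intervalIntegral_add_eq φ 0, zero_add, zsmul_eq_mul, zsmul_eq_mul] at hn
  rw [← ellipticF_pi hm, ellipticF, ellipticF, ellipticF, ← hn,
    intervalIntegral.integral_add_adjacent_intervals (hint _ _) (hint _ _)]

lemma jacobiAm_ellipticF (φ : ℝ) : jacobiAm m (ellipticF m φ) = φ :=
  Function.leftInverse_invFun (ellipticF_strictMono hm).injective φ

lemma ellipticF_jacobiAm (u : ℝ) : ellipticF m (jacobiAm m u) = u :=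
  Function.rightInverse_invFun (ellipticF_surjective hm) u

lemma jacobiAm_neg (u : ℝ) : jacobiAm m (-u) = -jacobiAm m u := by
  rw [← jacobiAm_ellipticF hm (-jacobiAm m u), ellipticF_neg, ellipticF_jacobiAm hm]

lemma jacobiAm_add_two_mul_ellipticK (u : ℝ) :
    jacobiAm m (u + 2 * ellipticK m) = jacobiAm m u + Real.pi := by
  have hadd := ellipticF_add_int_mul_pi hm (jacobiAm m u) 1
  rw [Int.cast_one, one_mul, one_mul, ellipticF_jacobiAm hm] at hadd
  rw [← hadd, jacobiAm_ellipticF hm]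

lemma sin_jacobiAm_eq_zero_iff (u : ℝ) :
    Real.sin (jacobiAm m u) = 0 ↔ ∃ n : ℤ, u = n * (2 * ellipticK m) := by
  have hn (n : ℤ) : ellipticF m (n * Real.pi) = n * (2 * ellipticK m) := by
    simpa [ellipticF] using ellipticF_add_int_mul_pi hm 0 n
  rw [Real.sin_eq_zero_iff]
  refine exists_congr fun n => ⟨fun h => ?_, fun h => ?_⟩
  · rw [← hn, h, ellipticF_jacobiAm hm]
  · rw [h, ← hn, jacobiAm_ellipticF hm]

lemma jacobiAm_zero : jacobiAm m 0 = 0 := by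
  simpa [ellipticF] using jacobiAm_ellipticF hm 0

lemma continuous_jacobiAm : Continuous (jacobiAm m) := by
  have hsymm : jacobiAm m =
      ((ellipticF_strictMono hm).orderIsoOfSurjective _ (ellipticF_surjective hm)).symm :=
    funext fun u => ((OrderIso.symm_apply_eq _).2 (ellipticF_jacobiAm hm u).symm).symm
  rw [hsymm]
  exact OrderIso.continuous _

lemma hasDerivAt_jacobiAm (u : ℝ) :
    HasDerivAt (jacobiAm m) √(1 - m * Real.sin (jacobiAm m u) ^ 2) u := by
  have hne := (Real.sqrt_pos.2 (one_sub_mul_sin_sq_pos hm (jacobiAm m u))).ne'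
  have hinv := (hasDerivAt_ellipticF hm _).of_local_left_inverse
    (continuous_jacobiAm hm).continuousAt (one_div_ne_zero hne)
    (Filter.Eventually.of_forall (ellipticF_jacobiAm hm))
  rwa [inv_div, div_one] at hinv

lemma hasDerivAt_sin_jacobiAm_sq (u : ℝ) :
    HasDerivAt (fun u => Real.sin (jacobiAm m u) ^ 2)
      (2 * Real.sin (jacobiAm m u) * Real.cos (jacobiAm m u) *
        √(1 - m * Real.sin (jacobiAm m u) ^ 2)) u :=
  ((hasDerivAt_jacobiAm hm u).sin.fun_pow 2).congr_deriv (by push_cast; ring)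

lemma hasDerivAt_deriv_sin_jacobiAm_sq (u : ℝ) :
    HasDerivAt (fun u => 2 * Real.sin (jacobiAm m u) * Real.cos (jacobiAm m u) *
        √(1 - m * Real.sin (jacobiAm m u) ^ 2))
      (2 - 4 * (1 + m) * Real.sin (jacobiAm m u) ^ 2 + 6 * m * Real.sin (jacobiAm m u) ^ 4) u := by
  have hpos := one_sub_mul_sin_sq_pos hm (jacobiAm m u)
  have ham := hasDerivAt_jacobiAm hm u
  have hne := (Real.sqrt_pos.2 hpos).ne'
  have hsq := Real.sq_sqrt hpos.le
  refine (((ham.sin.const_mul 2).fun_mul ham.cos).fun_mul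
    (((hasDerivAt_sin_jacobiAm_sq hm u).const_mul m).const_sub 1 |>.sqrt hpos.ne')).congr_deriv ?_
  set s := Real.sin (jacobiAm m u)
  set c := Real.cos (jacobiAm m u)
  set q := √(1 - m * s ^ 2)
  have hc : c ^ 2 = 1 - s ^ 2 := Real.cos_sq' _
  field_simp
  linear_combination (2 * c ^ 2 - 2 * s ^ 2) * hsq + (2 - 4 * m * s ^ 2) * hc

end Elliptic

/-! ### The profile of the metric -/

lemma eq_zero_of_hasDerivAt_clm_apply {E : Type*} [NormedAddCommGroup E] [NormedSpace ℝ E]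
    {A : ℝ → E →L[ℝ] E} (hA : Continuous A) {x : ℝ → E} (hx : ∀ t, HasDerivAt x (A t (x t)) t)
    {t₀ : ℝ} (h0 : x t₀ = 0) (t : ℝ) : x t = 0 := by
  set R := |t| + |t₀| + 1
  have ht : t ∈ Set.Ioo (-R) R := abs_lt.1 (by linarith [abs_nonneg t₀])
  have ht₀ : t₀ ∈ Set.Ioo (-R) R := abs_lt.1 (by linarith [abs_nonneg t])
  obtain ⟨K, hK⟩ := isCompact_Icc.exists_bound_of_continuousOn
    (hA.continuousOn (s := Set.Icc (-R) R))
  refine ODE_solution_unique_of_mem_Ioo (v := fun s => A s) (s := fun _ => Set.univ)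
    (g := 0) (K := K.toNNReal) (fun s hs => ?_) ht₀ (fun s _ => ⟨hx s, Set.mem_univ _⟩)
    (fun s _ => ⟨?_, Set.mem_univ _⟩) h0 ht
  · refine ((A s).lipschitz.weaken ?_).lipschitzOnWith
    exact NNReal.le_toNNReal_of_coe_le (hK s (Set.Ioo_subset_Icc_self hs))
  · simp

lemma eq_zero_of_hasDerivAt_mul {c x x' : ℝ → ℝ} (hc : Continuous c)
    (hx : ∀ t, HasDerivAt x (x' t) t) (hx' : ∀ t, HasDerivAt x' (c t * x t) t) {t₀ : ℝ}
    (h0 : x t₀ = 0) (h0' : x' t₀ = 0) (t : ℝ) : x t = 0 := by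
  have key := eq_zero_of_hasDerivAt_clm_apply (x := fun t => (x t, x' t))
    (A := fun t => .inl ℝ ℝ ℝ ∘L .snd ℝ ℝ ℝ + c t • .inr ℝ ℝ ℝ ∘L .fst ℝ ℝ ℝ)
    (by fun_prop) (fun t => ((hx t).prodMk (hx' t)).congr_deriv (by simp)) (t₀ := t₀)
    (by simp [h0, h0']) t
  exact congr($key.1)

/-- The metric factor `w(y)`, normalized to be critical at `0`, of a translationally equivariant
minimal Lagrangian surface with Hopf differential `ψ dz³`. -/
structure IsProfile (w : ℝ → ℝ) (ψ : ℂ) : Prop where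
  contDiff : ContDiff ℝ 2 w
  pos : ∀ y, 0 < w y
  deriv_zero : deriv w 0 = 0
  gauss : ∀ y, w y * deriv (deriv w) y = deriv w y ^ 2 + 4 * ‖ψ‖ ^ 2 - 4 * w y ^ 3

lemma IsMinLagLift.isProfile {F : ℂ → C3} {w : ℝ → ℝ} {ψ : ℂ}
    (h : IsMinLagLift F (fun z => w z.im) fun _ => ψ) (h0 : deriv w 0 = 0) : IsProfile w ψ := by
  have hw : ContDiff ℝ 2 w := mod_cast contDiff_infty.1 h.contDiff_profile 2
  refine ⟨hw, fun y => by simpa using h.metric_pos (y * Complex.I), h0, fun y => ?_⟩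
  have hy : (y * Complex.I).im = y := by simp
  have hd : HasDerivAt (fun y => -(Complex.I / 2) * deriv w y)
      (-(Complex.I / 2) * deriv (deriv w) y) (y * Complex.I).im := by
    rw [hy]
    exact (hw.differentiable_deriv_two y).hasDerivAt.ofReal_comp.const_mul _
  have key := h.gauss_equation (y * Complex.I)
  rw [funext h.wirtinger_profile, wirtingerBar_comp_im hd] at key
  simp only [hy, norm_mul, norm_neg, norm_div, Complex.norm_I, Complex.norm_real,
    Real.norm_eq_abs, Complex.norm_two, ← Complex.ofReal_pow, mul_pow, sq_abs, smul_eq_mul] at key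
  apply Complex.ofReal_injective
  push_cast at key ⊢
  linear_combination 4 * key + w y * (deriv (deriv w) y : ℝ) * Complex.I_sq

namespace IsProfile

variable {w : ℝ → ℝ} {ψ : ℂ} (h : IsProfile w ψ)
include h

lemma hasDerivAt (y : ℝ) : HasDerivAt w (deriv w y) y :=
  (h.contDiff.differentiable (by simp) y).hasDerivAt

lemma deriv_sq (y : ℝ) :
    deriv w y ^ 2 = 4 * betaConst ψ (w 0) * w y ^ 2 - 8 * w y ^ 3 - 4 * ‖ψ‖ ^ 2 := by
  have hne (y : ℝ) : w y ≠ 0 := (h.pos y).ne'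
  have hd (y : ℝ) : HasDerivAt (fun y => (deriv w y ^ 2 + 8 * w y ^ 3 + 4 * ‖ψ‖ ^ 2) / w y ^ 2)
      0 y := by
    have hw := h.hasDerivAt y
    have hw' : HasDerivAt (deriv w) (deriv (deriv w) y) y :=
      (h.contDiff.differentiable_deriv_two y).hasDerivAt
    refine ((((hw'.fun_pow 2).fun_add ((hw.fun_pow 3).const_mul 8)).add_const (4 * ‖ψ‖ ^ 2)).fun_div
      (hw.fun_pow 2) (pow_ne_zero 2 (hne y))).congr_deriv ?_
    rw [div_eq_zero_iff]
    left
    push_cast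
    linear_combination 2 * w y * deriv w y * h.gauss y
  have key := is_const_of_deriv_eq_zero (fun y => (hd y).differentiableAt)
    (fun y => (hd y).deriv) y 0
  rw [h.deriv_zero, div_eq_iff (pow_ne_zero 2 (hne y))] at key
  have h0 := hne 0
  rw [betaConst]
  field_simp at key ⊢
  linear_combination key

lemma hasDerivAt_deriv (y : ℝ) :
    HasDerivAt (deriv w) (4 * betaConst ψ (w 0) * w y - 12 * w y ^ 2) y := by
  refine (h.contDiff.differentiable_deriv_two y).hasDerivAt.congr_deriv ?_
  apply mul_left_cancel₀ (h.pos y).ne'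
  linear_combination h.gauss y + h.deriv_sq y

lemma eq_of_hasDerivAt {v v' : ℝ → ℝ} (hv : ∀ y, HasDerivAt v (v' y) y)
    (hv' : ∀ y, HasDerivAt v' (4 * betaConst ψ (w 0) * v y - 12 * v y ^ 2) y)
    (h0 : v 0 = w 0) (h0' : v' 0 = 0) (y : ℝ) : w y = v y := by
  have hcw : Continuous w := h.contDiff.continuous
  have hcv : Continuous v := continuous_iff_continuousAt.2 fun y => (hv y).continuousAt
  refine sub_eq_zero.1 (eq_zero_of_hasDerivAt_mul (t₀ := 0)
    (c := fun y => 4 * betaConst ψ (w 0) - 12 * (w y + v y)) (by fun_prop)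
    (fun y => (h.hasDerivAt y).fun_sub (hv y))
    (fun y => ((h.hasDerivAt_deriv y).fun_sub (hv' y)).congr_deriv (by ring)) ?_ ?_ y)
  · rw [h0, sub_self]
  · rw [h.deriv_zero, h0', sub_zero]

lemma eq_const_of_pow_three_eq (h0 : w 0 ^ 3 = ‖ψ‖ ^ 2) (y : ℝ) : w y = w 0 := by
  refine h.eq_of_hasDerivAt (fun _ => hasDerivAt_const _ _)
    (fun _ => (hasDerivAt_const _ _).congr_deriv ?_) rfl rfl y
  have := (h.pos 0).ne'
  rw [betaConst, ← h0]
  field_simp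
  ring

end IsProfile

section Roots

variable {ψ : ℂ} {a : ℝ}

lemma betaConst_eq_add_sub (ψ : ℂ) (a : ℝ) : betaConst ψ a = 2 * (a + a2 ψ a - a3 ψ a) := by
  rw [a2, a3]
  ring

variable (hψ : ψ ≠ 0) (ha : 0 < a)
include hψ ha

lemma betaConst_div_two_sub_pos : 0 < betaConst ψ a / 2 - a := by
  have hψ := norm_pos_iff.2 hψ
  rw [betaConst, add_div, mul_div_cancel_left₀ _ two_ne_zero, add_sub_cancel_left]
  positivity

lemma mul_a2 : a * a2 ψ a = a3 ψ a * (a + a2 ψ a) := by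
  have hc := betaConst_div_two_sub_pos hψ ha
  have hsq := Real.sq_sqrt (show 0 ≤ (betaConst ψ a / 2 - a) ^ 2 +
    4 * a * (betaConst ψ a / 2 - a) by positivity)
  rw [a2, a3]
  linear_combination -hsq / 4

lemma a3_pos : 0 < a3 ψ a := by
  have hc := betaConst_div_two_sub_pos hψ ha
  have hlt := Real.lt_sqrt_of_sq_lt (lt_add_of_pos_right ((betaConst ψ a / 2 - a) ^ 2)
    (show 0 < 4 * a * (betaConst ψ a / 2 - a) by positivity))
  rw [a3]
  linarith

lemma sub_a2_div_lt_one : (a - a2 ψ a) / (a + a3 ψ a) < 1 := by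
  have h3 := a3_pos hψ ha
  rw [div_lt_one (by positivity)]
  linarith [betaConst_div_two_sub_pos hψ ha, betaConst_eq_add_sub ψ a]

end Roots

namespace IsProfile

variable {w : ℝ → ℝ} {ψ : ℂ} (h : IsProfile w ψ) (hψ : ψ ≠ 0)
include h hψ

lemma eq_sub_mul_sin_jacobiAm_sq (y : ℝ) :
    w y = w 0 - (w 0 - a2 ψ (w 0)) * Real.sin (jacobiAm ((w 0 - a2 ψ (w 0)) / (w 0 + a3 ψ (w 0)))
      (√(2 * (w 0 + a3 ψ (w 0))) * y)) ^ 2 := by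
  have hrel := mul_a2 hψ (h.pos 0)
  have hpos : 0 < w 0 + a3 ψ (w 0) := add_pos (h.pos 0) (a3_pos hψ (h.pos 0))
  have hm := sub_a2_div_lt_one hψ (h.pos 0)
  have hβ := betaConst_eq_add_sub ψ (w 0)
  set b := a2 ψ (w 0)
  set c := a3 ψ (w 0)
  set m := (w 0 - b) / (w 0 + c)
  have hmc : m * (w 0 + c) = w 0 - b := div_mul_cancel₀ _ hpos.ne'
  have hr : √(2 * (w 0 + c)) ^ 2 = 2 * (w 0 + c) := Real.sq_sqrt (by positivity)
  set r := √(2 * (w 0 + c))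
  have hry (y : ℝ) : HasDerivAt (fun y => r * y) r y := by
    simpa using (hasDerivAt_id y).const_mul r
  refine h.eq_of_hasDerivAt
    (fun y => (((hasDerivAt_sin_jacobiAm_sq hm (r * y)).comp y (hry y)).const_mul _).const_sub _)
    (fun y => ((((hasDerivAt_deriv_sin_jacobiAm_sq hm (r * y)).comp y (hry y)).mul_const
      r).const_mul _).fun_neg.congr_deriv ?_) ?_ ?_ y
  · rw [hβ, Function.comp_apply]
    set s := Real.sin (jacobiAm m (r * y))
    linear_combination (b - w 0) * (2 - 4 * (1 + m) * s ^ 2 + 6 * m * s ^ 4) * hr +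
      2 * (w 0 - b) * (4 * s ^ 2 - 6 * s ^ 4) * hmc - 4 * hrel
  · simp [jacobiAm_zero hm]
  · simp [jacobiAm_zero hm]

lemma sqrt_two_mul_add_a3_pos : 0 < √(2 * (w 0 + a3 ψ (w 0))) :=
  Real.sqrt_pos.2 (by linarith [h.pos 0, a3_pos hψ (h.pos 0)])

lemma add_two_mul_halfPeriod (y : ℝ) : w (y + 2 * halfPeriod ψ (w 0)) = w y := by
  rw [h.eq_sub_mul_sin_jacobiAm_sq hψ, h.eq_sub_mul_sin_jacobiAm_sq hψ y, halfPeriod, mul_add,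
    mul_left_comm, mul_div_cancel₀ _ (h.sqrt_two_mul_add_a3_pos hψ).ne',
    jacobiAm_add_two_mul_ellipticK (sub_a2_div_lt_one hψ (h.pos 0)), Real.sin_add_pi, neg_sq]

lemma even (y : ℝ) : w (-y) = w y := by
  rw [h.eq_sub_mul_sin_jacobiAm_sq hψ, h.eq_sub_mul_sin_jacobiAm_sq hψ y, mul_neg,
    jacobiAm_neg (sub_a2_div_lt_one hψ (h.pos 0)), Real.sin_neg, neg_sq]

lemma halfPeriod_pos : 0 < halfPeriod ψ (w 0) :=
  div_pos (ellipticK_pos (sub_a2_div_lt_one hψ (h.pos 0)))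
    (h.sqrt_two_mul_add_a3_pos hψ)

lemma eq_int_mul_of_eq (hne : ∃ y, w y ≠ w 0) {y : ℝ} (hy : w y = w 0) :
    ∃ n : ℤ, y = n * (2 * halfPeriod ψ (w 0)) := by
  have hw := h.eq_sub_mul_sin_jacobiAm_sq hψ
  have hr := (h.sqrt_two_mul_add_a3_pos hψ).ne'
  have hne : w 0 - a2 ψ (w 0) ≠ 0 := fun h0 => hne.elim fun y hy => hy (by simpa [h0] using hw y)
  rw [hw, sub_eq_self, mul_eq_zero, or_iff_right hne, sq_eq_zero_iff,
    sin_jacobiAm_eq_zero_iff (sub_a2_div_lt_one hψ (h.pos 0))] at hy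
  obtain ⟨n, hn⟩ := hy
  refine ⟨n, ?_⟩
  rw [halfPeriod]
  field_simp
  linear_combination hn

end IsProfile

/-! ### Rationality conditions and the spectral curve -/

lemma forall_circle_exp_eq_iff {x : Fin 3 → ℝ} :
    (∀ i j, Circle.exp (x i) = Circle.exp (x j)) ↔
      (∃ m : ℤ, x 0 - x 1 = m * (2 * Real.pi)) ∧ ∃ n : ℤ, x 0 - x 2 = n * (2 * Real.pi) := by
  simp_rw [sub_eq_iff_eq_add', ← Circle.exp_eq_exp]
  refine ⟨fun h => ⟨h 0 1, h 0 2⟩, fun ⟨h₁, h₂⟩ => ?_⟩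
  have h₀ : ∀ i, Circle.exp (x i) = Circle.exp (x 0) :=
    Fin.forall_fin_succ.2 ⟨rfl, Fin.forall_fin_two.2 ⟨h₁.symm, h₂.symm⟩⟩
  exact fun i j => (h₀ i).trans (h₀ j).symm

lemma exists_ne_zero_mul_two_pi_iff {p q : ℝ} (hp : p ≠ 0) :
    (∃ s ≠ 0, (∃ m : ℤ, p * s = m * (2 * Real.pi)) ∧ ∃ n : ℤ, q * s = n * (2 * Real.pi)) ↔
      ∃ r : ℚ, q / p = r := by
  constructor
  · rintro ⟨s, hs, ⟨m, hm⟩, n, hn⟩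
    refine ⟨n / m, ?_⟩
    rw [← mul_div_mul_right q p hs, hm, hn, mul_div_mul_right _ _ Real.two_pi_pos.ne']
    norm_cast
  · rintro ⟨r, hr⟩
    have hden : (r.den : ℝ) ≠ 0 := Nat.cast_ne_zero.2 r.den_ne_zero
    refine ⟨2 * Real.pi * r.den / p, by positivity, ⟨r.den, ?_⟩, r.num, ?_⟩
    · rw [mul_div_cancel₀ _ hp, mul_comm, Int.cast_natCast]
    · have hnum : (r * r.den : ℝ) = r.num := mod_cast r.mul_den_eq_num
      rw [← hnum, ← hr]
      ring

lemma exists_int_ne_zero_mul_two_pi_iff {p q α γ : ℝ} (hp : p ≠ 0) (hr : ∃ r : ℚ, q / p = r) :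
    (∃ s : ℝ, ∃ n : ℤ, n ≠ 0 ∧ (∃ k : ℤ, p * s + n * α = k * (2 * Real.pi)) ∧
      ∃ l : ℤ, q * s + n * γ = l * (2 * Real.pi)) ↔
      ∃ r : ℚ, (γ - q / p * α) / (2 * Real.pi) = r := by
  have hpi := Real.pi_pos.ne'
  obtain ⟨r, hr⟩ := hr
  constructor
  · rintro ⟨s, n, hn, ⟨k, hk⟩, l, hl⟩
    have hn' : (n : ℝ) ≠ 0 := Int.cast_ne_zero.2 hn
    refine ⟨(l - r * k) / n, ?_⟩
    push_cast
    rw [div_eq_div_iff (by positivity) hn', ← hr]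
    field_simp
    linear_combination p * hl - q * hk
  · rintro ⟨t, ht⟩
    have hnum : (t * t.den : ℝ) = t.num := mod_cast t.mul_den_eq_num
    refine ⟨-t.den * α / p, t.den, mod_cast t.den_ne_zero, ⟨0, ?_⟩, t.num, ?_⟩
    · push_cast
      field_simp
      ring
    · rw [← hnum, ← ht]
      push_cast
      field_simp
      ring

lemma exists_rat_div_sub_iff {a b c : ℝ} (hsum : a + b + c = 0) (hab : a ≠ b) :
    (∃ q : ℚ, (a - c) / (a - b) = q) ↔ b = 0 ∨ ∃ q : ℚ, a / b = q := by
  obtain rfl : c = -a - b := by linarith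
  have hab' : a - b ≠ 0 := sub_ne_zero.2 hab
  rcases eq_or_ne b 0 with rfl | hb
  · rw [sub_zero] at hab'
    exact iff_of_true ⟨2, by push_cast; field_simp; ring⟩ (Or.inl rfl)
  rw [or_iff_right hb]
  constructor
  · rintro ⟨q, hq⟩
    refine ⟨(q + 1) / (q - 2), ?_⟩
    have hq2 : (q : ℝ) - 2 ≠ 0 := fun h0 => hb (by
      rw [div_eq_iff hab', sub_eq_zero.1 h0] at hq; linarith)
    push_cast
    rw [div_eq_div_iff hb hq2]
    rw [div_eq_iff hab'] at hq
    linear_combination -hq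
  · rintro ⟨q, hq⟩
    refine ⟨(2 * q + 1) / (q - 1), ?_⟩
    have hq1 : (q : ℝ) - 1 ≠ 0 := by
      rwa [← hq, ← div_self hb, ← sub_div, div_ne_zero_iff, and_iff_left hb]
    push_cast
    rw [div_eq_div_iff hab' hq1]
    rw [div_eq_iff hb] at hq
    linear_combination -3 * hq

lemma exists_ne_zero_circle_exp_iff {d : Fin 3 → ℝ} (hd : d 0 ≠ d 1)
    (hsum : d 0 + d 1 + d 2 = 0) :
    (∃ s ≠ 0, ∀ i j, Circle.exp (d i * s) = Circle.exp (d j * s)) ↔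
      d 1 = 0 ∨ ∃ q : ℚ, d 0 / d 1 = q := by
  rw [← exists_rat_div_sub_iff hsum hd, ← exists_ne_zero_mul_two_pi_iff (sub_ne_zero.2 hd)]
  exact exists_congr fun s => and_congr_right fun _ => by
    simp only [forall_circle_exp_eq_iff (x := fun i => d i * s), sub_mul]

lemma exists_int_ne_zero_circle_exp_iff {d θ : Fin 3 → ℝ} {J K β : ℝ} (hd : d 0 ≠ d 1)
    (hsum : d 0 + d 1 + d 2 = 0) (hβ : d 0 * d 1 + d 0 * d 2 + d 1 * d 2 = -β)
    (hθ : ∀ i j, θ i - θ j = (d i ^ 2 - d j ^ 2) * J + (d i - d j) * K)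
    (hq : d 1 = 0 ∨ ∃ q : ℚ, d 0 / d 1 = q) :
    (∃ s : ℝ, ∃ n : ℤ, n ≠ 0 ∧
        ∀ i j, Circle.exp (d i * s + n * θ i) = Circle.exp (d j * s + n * θ j)) ↔
      ∃ q : ℚ, 1 / (2 * Real.pi) * J * (d 0 * d 1 + 2 * β / 3) = q := by
  have hd' := sub_ne_zero.2 hd
  have hpi := Real.pi_pos.ne'
  have hγ : (θ 0 - θ 2 - (d 0 - d 2) / (d 0 - d 1) * (θ 0 - θ 1)) / (2 * Real.pi) =
      -3 * (1 / (2 * Real.pi) * J * (d 0 * d 1 + 2 * β / 3)) := by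
    obtain rfl : β = -(d 0 * d 1 + d 0 * d 2 + d 1 * d 2) := by linarith
    obtain h2 : d 2 = -d 0 - d 1 := by linarith
    rw [hθ, hθ, h2]
    field_simp
    ring
  have key := exists_int_ne_zero_mul_two_pi_iff (α := θ 0 - θ 1) (γ := θ 0 - θ 2) hd'
    ((exists_rat_div_sub_iff hsum hd).2 hq)
  rw [hγ] at key
  trans ∃ q : ℚ, -3 * (1 / (2 * Real.pi) * J * (d 0 * d 1 + 2 * β / 3)) = q
  · rw [← key]
    exact exists_congr fun s => exists_congr fun n => and_congr_right fun _ => by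
      simp only [forall_circle_exp_eq_iff (x := fun i => d i * s + n * θ i), add_sub_add_comm,
        sub_mul, mul_sub]
  · exact ⟨fun ⟨q, h⟩ => ⟨-q / 3, by push_cast; linarith⟩,
      fun ⟨q, h⟩ => ⟨-3 * q, by push_cast; rw [h]⟩⟩

lemma eval_charpoly_potential {ψ lam : ℂ} {u₀ : ℝ} (hlam : ‖lam‖ = 1) (t : ℝ) :
    (potential ψ u₀ lam).charpoly.eval (Complex.I * t) = -Complex.I *
      (t ^ 3 - betaConst ψ (Real.exp u₀) * t + 2 * (lam⁻¹ ^ 3 * ψ).re : ℝ) := by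
  have hlam0 : lam ≠ 0 := norm_ne_zero_iff.1 (by simp [hlam])
  have hconj : conj lam = lam⁻¹ := (Complex.inv_eq_conj hlam).symm
  have hre : (2 * (lam⁻¹ ^ 3 * ψ).re : ℂ) = lam⁻¹ ^ 3 * ψ + lam ^ 3 * conj ψ := by
    rw [← Complex.ofReal_ofNat, ← Complex.ofReal_mul, ← Complex.add_conj]
    simp only [map_mul, map_pow, map_inv₀, hconj, inv_inv]
  have hs0 : (Real.exp (u₀ / 2) : ℂ) ≠ 0 := Complex.ofReal_ne_zero.2 (Real.exp_ne_zero _)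
  have hsq : (Real.exp u₀ : ℂ) = (Real.exp (u₀ / 2) : ℂ) ^ 2 := (ofReal_exp_half_sq u₀).symm
  have hneg : (Real.exp (-u₀) : ℂ) = (Real.exp u₀ : ℂ)⁻¹ := by
    rw [Real.exp_neg, Complex.ofReal_inv]
  rw [Matrix.eval_charpoly, Matrix.det_fin_three, betaConst, ← Complex.normSq_eq_norm_sq]
  simp only [Matrix.sub_apply, Matrix.scalar_apply, Matrix.diagonal_apply, potential,
    Matrix.of_apply, Matrix.cons_val, hneg, Complex.ofReal_add, Complex.ofReal_sub,
    Complex.ofReal_mul, Complex.ofReal_div, Complex.ofReal_pow, Complex.ofReal_ofNat,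
    Complex.normSq_eq_conj_mul_self, hre, hsq]
  generalize (Real.exp (u₀ / 2) : ℂ) = s at hs0
  simp only [↓reduceIte, sub_zero, Fin.isValue, Fin.reduceEq, zero_sub, mul_neg, neg_mul, neg_neg,
    zero_ne_one, sub_neg_eq_add, zero_add, one_ne_zero, inv_pow]
  field_simp
  linear_combination (lam ^ 6 * s ^ 4 * conj ψ + s ^ 4 * ψ + lam ^ 3 * t ^ 3 * s ^ 4 -
    2 * lam ^ 3 * t * s ^ 6 - lam ^ 3 * t * conj ψ * ψ) * Complex.I_sq

lemma cubic_of_charpoly_potential {ψ lam : ℂ} {u₀ : ℝ} (hlam : ‖lam‖ = 1) {d : Fin 3 → ℝ}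
    (hd : (potential ψ u₀ lam).charpoly =
      ∏ j, (Polynomial.X - Polynomial.C (Complex.I * (d j : ℂ)))) (t : ℝ) :
    t ^ 3 - betaConst ψ (Real.exp u₀) * t + 2 * (lam⁻¹ ^ 3 * ψ).re =
      (t - d 0) * (t - d 1) * (t - d 2) := by
  have key := congr(Polynomial.eval (Complex.I * t) $hd)
  rw [eval_charpoly_potential hlam, Polynomial.eval_prod, Fin.prod_univ_three] at key
  simp only [Polynomial.eval_sub, Polynomial.eval_X, Polynomial.eval_C] at key
  have hI : -Complex.I ≠ 0 := neg_ne_zero.2 Complex.I_ne_zero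
  rw [← Complex.ofReal_inj, ← mul_right_inj' hI, key]
  push_cast
  linear_combination (Complex.I * ((t - d 0) * (t - d 1) * (t - d 2))) * Complex.I_sq

lemma cubic_coefficients {β a : ℝ} {d : Fin 3 → ℝ}
    (h : ∀ t : ℝ, t ^ 3 - β * t + 2 * a = (t - d 0) * (t - d 1) * (t - d 2)) :
    d 0 + d 1 + d 2 = 0 ∧ d 0 * d 1 + d 0 * d 2 + d 1 * d 2 = -β ∧
      d 0 * d 1 * d 2 = -(2 * a) := by
  refine ⟨?_, ?_, ?_⟩ <;> linarith [h 0, h 1, h (-1)]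

lemma eq_or_eq_or_eq_of_not_injective {α : Type*} {d : Fin 3 → α} (hd : ¬ Function.Injective d) :
    d 0 = d 1 ∨ d 0 = d 2 ∨ d 1 = d 2 := by
  contrapose! hd
  obtain ⟨h01, h02, h12⟩ := hd
  intro i j hij
  fin_cases i <;> fin_cases j <;>
    first | rfl | exact absurd hij ‹_› | exact absurd hij.symm ‹_›

lemma exists_cubic_double_root {β a : ℝ} {d : Fin 3 → ℝ}
    (h : ∀ t : ℝ, t ^ 3 - β * t + 2 * a = (t - d 0) * (t - d 1) * (t - d 2))
    (hd : ¬ Function.Injective d) : ∃ x : ℝ, β = 3 * x ^ 2 ∧ a = x ^ 3 := by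
  obtain ⟨hsum, hβ, ha⟩ := cubic_coefficients h
  obtain h2 : d 2 = -d 0 - d 1 := by linarith
  rw [h2] at hβ ha
  rcases eq_or_eq_or_eq_of_not_injective hd with h' | h' | h'
  · exact ⟨d 0, by rw [← h'] at hβ; linarith, by rw [← h'] at ha; linarith⟩
  · have h1 : d 1 = -2 * d 0 := by linarith
    exact ⟨d 0, by rw [h1] at hβ; linarith, by rw [h1] at ha; linarith⟩
  · have h0 : d 0 = -2 * d 1 := by linarith
    exact ⟨d 1, by rw [h0] at hβ; linarith, by rw [h0] at ha; linarith⟩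

lemma exists_rat_div_of_not_injective {d : Fin 3 → ℝ} (hd : ¬ Function.Injective d)
    (hsum : d 0 + d 1 + d 2 = 0) : d 1 = 0 ∨ ∃ q : ℚ, d 0 / d 1 = q := by
  refine or_iff_not_imp_left.2 fun h1 => ?_
  rcases eq_or_eq_or_eq_of_not_injective hd with h | h | h
  · exact ⟨1, by rw [h, div_self h1, Rat.cast_one]⟩
  · exact ⟨-1 / 2, by rw [div_eq_iff h1]; push_cast; linarith⟩
  · exact ⟨-2, by rw [div_eq_iff h1]; push_cast; linarith⟩

lemma eq_sq_of_betaConst_eq {ψ : ℂ} {w₀ x : ℝ} (hw : 0 < w₀)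
    (hβ : betaConst ψ w₀ = 3 * x ^ 2) (hx : x ^ 6 ≤ ‖ψ‖ ^ 2) : w₀ = x ^ 2 ∧ ‖ψ‖ ^ 2 = x ^ 6 := by
  have key : (w₀ - x ^ 2) ^ 2 * (2 * w₀ + x ^ 2) + (‖ψ‖ ^ 2 - x ^ 6) = 0 := by
    rw [betaConst] at hβ
    field_simp at hβ
    linear_combination hβ
  obtain ⟨hsq, hnorm⟩ := (add_eq_zero_iff_of_nonneg (by positivity) (sub_nonneg.2 hx)).1 key
  exact ⟨sub_eq_zero.1 (pow_eq_zero_iff two_ne_zero |>.1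
    ((mul_eq_zero.1 hsq).resolve_right (by positivity))), sub_eq_zero.1 hnorm⟩

/-! ### The torus condition for a non-constant metric -/

namespace IsMinLagLift

variable {F : ℂ → C3} {w : ℝ → ℝ} {ψ : ℂ} (h : IsMinLagLift F (fun z => w z.im) fun _ => ψ)
include h

lemma phase_sub_phase (hre : ψ.re ≠ 0) (τ d d' : ℝ) :
    phase w ψ τ d - phase w ψ τ d' =
      (d ^ 2 - d' ^ 2) * (∫ y in (0 : ℝ)..τ, ψ.re * w y / (deriv w y ^ 2 / 4 + ψ.re ^ 2)) +
      (d - d') * ∫ y in (0 : ℝ)..τ, -(ψ.re * ψ.im) / (deriv w y ^ 2 / 4 + ψ.re ^ 2) := by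
  have hw := h.contDiff_profile.continuous
  have hw' := h.continuous_deriv_profile
  have hint {g : ℝ → ℝ} (hg : Continuous g) : IntervalIntegrable
      (fun y => g y / (deriv w y ^ 2 / 4 + ψ.re ^ 2)) MeasureTheory.volume 0 τ :=
    (Continuous.div hg (by fun_prop) fun y => by positivity).intervalIntegrable _ _
  rw [phase, phase, ← intervalIntegral.integral_sub (hint (by fun_prop)) (hint (by fun_prop)),
    ← intervalIntegral.integral_const_mul, ← intervalIntegral.integral_const_mul,
    ← intervalIntegral.integral_add ((hint (by fun_prop)).const_mul _)
      ((hint (by fun_prop)).const_mul _)]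
  congr with y
  ring

lemma descendsToTorus_iff_of_not_const {f : ℂ → CP2} (hF : IsHorizontalLift f F)
    (h0 : deriv w 0 = 0) (hψ : ψ ≠ 0) (hne : ∃ y, w y ≠ w 0) {M : C3 →L[ℂ] C3}
    (hM : ∀ z, fderiv ℝ F z 1 = M (F z)) {d : Fin 3 → ℝ} {B : Module.Basis (Fin 3) ℂ C3}
    (hB : ∀ j, M (B j) = (Complex.I * d j) • B j) (hd : Function.Injective d) {β : ℝ}
    (hsum : d 0 + d 1 + d 2 = 0) (hβ : d 0 * d 1 + d 0 * d 2 + d 1 * d 2 = -β) :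
    DescendsToTorus f ↔ (d 1 = 0 ∨ ∃ q : ℚ, d 0 / d 1 = q) ∧ (ψ.re = 0 ∨ ∃ q : ℚ,
      1 / (2 * Real.pi) * (∫ y in (0 : ℝ)..2 * halfPeriod ψ (w 0),
        ψ.re * w y / (deriv w y ^ 2 / 4 + ψ.re ^ 2)) * (d 0 * d 1 + 2 * β / 3) = q) := by
  have hp := h.isProfile h0
  have hτ0 : 2 * halfPeriod ψ (w 0) ≠ 0 := by linarith [hp.halfPeriod_pos hψ]
  have hτ (y : ℝ) : w (2 * halfPeriod ψ (w 0) + y) = w y := by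
    rw [add_comm, hp.add_two_mul_halfPeriod hψ]
  have hmin (y : ℝ) (hy : w y = w 0) := hp.eq_int_mul_of_eq hψ hne hy
  have hd01 : d 0 ≠ d 1 := hd.ne (by decide)
  by_cases hre : ψ.re = 0
  · rw [h.descendsToTorus_iff_of_re_eq_zero hF hτ0 hτ hmin hM hB hd (hp.even hψ) hre,
      exists_ne_zero_circle_exp_iff hd01 hsum, and_iff_left (Or.inl hre)]
  · rw [h.descendsToTorus_iff_of_re_ne_zero hF hτ0 hτ hmin hM hB hd hre,
      exists_ne_zero_circle_exp_iff hd01 hsum, or_iff_right hre]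
    exact and_congr_right fun hq => exists_int_ne_zero_circle_exp_iff hd01 hsum hβ
      (fun i j => h.phase_sub_phase hre _ _ _) hq

end IsMinLagLift

lemma im_beta2 {ψ lam : ℂ} (hlam : ‖lam‖ = 1) {u : ℝ → ℝ} (hu : ContDiff ℝ 1 u)
    (him : (lam⁻¹ ^ 3 * ψ).im ≠ 0) (τ : ℝ) :
    (beta2 ψ lam u τ).im = ∫ y in (0 : ℝ)..τ, (lam⁻¹ ^ 3 * ψ).im * Real.exp (u y) /
      (deriv (fun y => Real.exp (u y)) y ^ 2 / 4 + (lam⁻¹ ^ 3 * ψ).im ^ 2) := by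
  have hconj : conj lam = lam⁻¹ := (Complex.inv_eq_conj hlam).symm
  have hμ : lam ^ 3 * conj ψ - lam⁻¹ ^ 3 * ψ = -(2 * (lam⁻¹ ^ 3 * ψ).im * Complex.I) := by
    rw [← neg_sub, ← Complex.ofReal_ofNat, ← Complex.ofReal_mul, ← Complex.sub_conj]
    simp only [map_mul, map_pow, map_inv₀, hconj, inv_inv]
  have hder (y : ℝ) : deriv (fun y => Real.exp (u y)) y = Real.exp (u y) * deriv u y :=
    ((hu.differentiable one_ne_zero y).hasDerivAt.exp).deriv
  have hu' : Continuous (deriv u) := hu.continuous_deriv le_rfl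
  have hcont := hu.continuous
  have key := im_intervalIntegral_div (N := fun y => Real.exp (u y))
    (D := fun y => -(Real.exp (u y) * deriv u y) / 2) (by fun_prop) (by fun_prop) him 0 τ
  rw [beta2, hμ]
  simp only [hder]
  convert key using 3 with y y
  · funext y
    refine Eq.trans ?_ (mul_div_mul_left _ _ (two_ne_zero' ℂ))
    push_cast
    congr 1
    ring
  · ring

/-! ### Constant metric -/

lemma eq_exp_smul_of_wirtinger_eq_smul {V : Type*} [NormedAddCommGroup V] [NormedSpace ℂ V]
    [NormedSpace ℝ V] [IsScalarTower ℝ ℂ V] {A : ℂ → V} {κ : ℂ} (hA : Differentiable ℝ A)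
    (h : ∀ z, wirtinger A z = κ • A z) (h' : ∀ z, wirtingerBar A z = -conj κ • A z) (z v : ℂ) :
    A (z + v) = Complex.exp (κ * v - conj (κ * v)) • A z := by
  set c : ℂ := κ * v - conj (κ * v)
  have hder (t : ℝ) : HasDerivAt (fun t : ℝ => Complex.exp (-(t * c)) • A (z + t * v)) 0 t := by
    have hexp : HasDerivAt (fun t : ℝ => Complex.exp (-(t * c)))
        (Complex.exp (-(t * c)) * -c) t := by
      simpa using ((Complex.ofRealCLM.hasDerivAt (x := t)).mul_const c).fun_neg.cexp
    refine (hexp.fun_smul (hasDerivAt_comp_line hA z v t)).congr_deriv ?_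
    rw [fderiv_apply_eq_wirtinger, h, h']
    simp only [c, map_mul]
    module
  have key := is_const_of_deriv_eq_zero (fun t => (hder t).differentiableAt)
    (fun t => (hder t).deriv) 0 1
  simp only [Complex.ofReal_zero, Complex.ofReal_one, zero_mul, neg_zero, Complex.exp_zero,
    one_smul, add_zero, one_mul] at key
  rw [key, smul_smul, ← Complex.exp_add, add_neg_cancel, Complex.exp_zero, one_smul]

lemma linearIndependent_ofReal_div_ofReal_mul_I_div {a b : ℝ} {κ : ℂ} (ha : a ≠ 0) (hb : b ≠ 0)
    (hκ : κ ≠ 0) : LinearIndependent ℝ ![(a / κ : ℂ), b * Complex.I / κ] := by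
  rw [LinearIndependent.pair_iff]
  intro s t hst
  have hst' : (s * a + t * (b * Complex.I) : ℂ) = 0 := by
    refine (div_eq_zero_iff.1 (Eq.trans ?_ hst)).resolve_right hκ
    simp only [Complex.real_smul]
    ring
  simpa [ha, hb] using And.intro congr(Complex.re $hst') congr(Complex.im $hst')

lemma exp_sub_conj_eq_one {a : ℂ} {n : ℤ} (ha : a.im = n * Real.pi) :
    Complex.exp (a - conj a) = 1 := by
  rw [Complex.sub_conj, ha, Complex.exp_eq_one_iff]
  exact ⟨n, by push_cast; ring⟩

lemma sq_add_self_add_one_eq_zero {ζ : ℂ} (hre : ζ.re = -1 / 2) (him : ζ.im = √3 / 2) :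
    ζ ^ 2 + ζ + 1 = 0 := by
  have h3 : √3 ^ 2 = 3 := Real.sq_sqrt zero_le_three
  rw [sq]
  apply Complex.ext
  · simp only [Complex.add_re, Complex.mul_re, hre, him, Complex.one_re, Complex.zero_re]
    linear_combination (-1 / 4) * h3
  · simp only [Complex.add_im, Complex.mul_im, hre, him, Complex.one_im, Complex.zero_im]
    ring

/-- For a lift `F` with constant metric `r` and Hopf differential `-κ³`, the solution of
`∂E = κ E`, `∂̄E = -κ̄ E` in the span of `F`, `∂F` and `∂̄F`. -/
noncomputable def flatEigenfunction (F : ℂ → C3) (r : ℝ) (κ z : ℂ) : C3 :=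
  F z + κ⁻¹ • wirtinger F z + (-(κ / r)) • wirtingerBar F z

lemma flatEigenfunction_add_add {ζ : ℂ} (hζ : ζ ^ 2 + ζ + 1 = 0) (F : ℂ → C3) (r : ℝ) (κ z : ℂ) :
    flatEigenfunction F r κ z + flatEigenfunction F r (ζ * κ) z +
      flatEigenfunction F r (ζ ^ 2 * κ) z = (3 : ℂ) • F z := by
  have hinv : ζ⁻¹ = ζ ^ 2 := by
    refine (eq_inv_of_mul_eq_one_left ?_).symm
    linear_combination (ζ - 1) * hζ
  simp only [flatEigenfunction, mul_inv, ← inv_pow, hinv]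
  match_scalars
  · norm_num
  · linear_combination (κ⁻¹ * (ζ ^ 2 - ζ + 1)) * hζ
  · linear_combination (-(κ / r)) * hζ

namespace IsMinLagLift

variable {F : ℂ → C3} {r : ℝ} {ψ : ℂ} (h : IsMinLagLift F (fun _ => r) fun _ => ψ)
include h

lemma differentiable_flatEigenfunction (κ : ℂ) : Differentiable ℝ (flatEigenfunction F r κ) :=
  (h.differentiable.fun_add (h.differentiable_wirtinger.fun_const_smul _)).fun_add
    (h.differentiable_wirtingerBar.fun_const_smul _)

lemma pow_three_eq_norm_sq_hopf : r ^ 3 = ‖ψ‖ ^ 2 := by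
  have key := h.gauss_equation 0
  have hconst : wirtinger (fun _ : ℂ => (r : ℂ)) = fun _ => 0 := funext fun _ => wirtinger_const _
  rw [hconst, wirtingerBar_const, mul_zero, norm_zero, Complex.ofReal_zero] at key
  exact_mod_cast (by linear_combination key : (r : ℂ) ^ 3 = ‖ψ‖ ^ 2)

variable {κ : ℂ} (hκ0 : κ ≠ 0) (hκ : κ ^ 3 = -ψ)
include hκ

lemma mul_conj_eq_of_pow_three_eq : κ * conj κ = r := by
  have hpow : (‖κ‖ ^ 2) ^ 3 = r ^ 3 := by
    rw [h.pow_three_eq_norm_sq_hopf, ← norm_neg ψ, ← hκ, norm_pow]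
    ring
  rw [Complex.mul_conj', ← Complex.ofReal_pow,
    (pow_left_inj₀ (by positivity) (h.metric_pos 0).le three_ne_zero).1 hpow]

include hκ0

lemma wirtinger_flatEigenfunction (z : ℂ) :
    wirtinger (flatEigenfunction F r κ) z = κ • flatEigenfunction F r κ z := by
  have hr : (r : ℂ) ≠ 0 := h.metric_ne_zero 0
  have hPP := h.smul_wirtinger_wirtinger z
  rw [wirtinger_const, zero_smul, zero_add, ← eq_inv_smul_iff₀ hr] at hPP
  have hP := h.differentiable_wirtinger z
  have hQ := h.differentiable_wirtingerBar z
  have hF := h.differentiable z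
  unfold flatEigenfunction
  rw [wirtinger_add (hF.fun_add (hP.fun_const_smul _)) (hQ.fun_const_smul _),
    wirtinger_add hF (hP.fun_const_smul _), wirtinger_smul (differentiableAt_const _) hP,
    wirtinger_smul (differentiableAt_const _) hQ, wirtinger_const, wirtinger_const, zero_smul,
    zero_add, zero_smul, zero_add, hPP, h.wirtinger_wirtingerBar, neg_eq_iff_eq_neg.1 hκ.symm]
  match_scalars <;> field_simp

lemma wirtingerBar_flatEigenfunction (z : ℂ) :
    wirtingerBar (flatEigenfunction F r κ) z = -conj κ • flatEigenfunction F r κ z := by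
  have hκc : conj κ ≠ 0 := (map_ne_zero _).2 hκ0
  have hr : (r : ℂ) ≠ 0 := h.metric_ne_zero 0
  have hQQ := h.smul_wirtingerBar_wirtingerBar z
  rw [wirtingerBar_const, zero_smul, zero_sub, ← eq_inv_smul_iff₀ hr] at hQQ
  have hP := h.differentiable_wirtinger z
  have hQ := h.differentiable_wirtingerBar z
  have hF := h.differentiable z
  unfold flatEigenfunction
  rw [wirtingerBar_add (hF.fun_add (hP.fun_const_smul _)) (hQ.fun_const_smul _),
    wirtingerBar_add hF (hP.fun_const_smul _), wirtingerBar_smul (differentiableAt_const _) hP,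
    wirtingerBar_smul (differentiableAt_const _) hQ, wirtingerBar_const, wirtingerBar_const,
    zero_smul, zero_add, zero_smul, zero_add, hQQ, h.wirtingerBar_wirtinger]
  simp only [← h.mul_conj_eq_of_pow_three_eq hκ, neg_eq_iff_eq_neg.1 hκ.symm, map_neg, map_pow]
  match_scalars <;> field_simp

lemma flatEigenfunction_add {v : ℂ} {n : ℤ} (hv : (κ * v).im = n * Real.pi) (z : ℂ) :
    flatEigenfunction F r κ (z + v) = flatEigenfunction F r κ z := by
  rw [eq_exp_smul_of_wirtinger_eq_smul (h.differentiable_flatEigenfunction κ)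
    (h.wirtinger_flatEigenfunction hκ0 hκ) (h.wirtingerBar_flatEigenfunction hκ0 hκ),
    exp_sub_conj_eq_one hv, one_smul]

lemma add_of_const {ζ : ℂ} (hζ : ζ ^ 2 + ζ + 1 = 0) {a : ℂ} {m n : ℤ} (ha : a.im = m * Real.pi)
    (hζa : (ζ * a).im = n * Real.pi) (z : ℂ) : F (z + a / κ) = F z := by
  have hζ3 : ζ ^ 3 = 1 := by linear_combination (ζ - 1) * hζ
  have hE {ξ : ℂ} (hξ : ξ ^ 3 = 1) {k : ℤ} (hk : (ξ * a).im = k * Real.pi) :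
      flatEigenfunction F r (ξ * κ) (z + a / κ) = flatEigenfunction F r (ξ * κ) z := by
    refine h.flatEigenfunction_add (mul_ne_zero ?_ hκ0) ?_ (n := k) ?_ z
    · exact fun h0 => by simp [h0] at hξ
    · rw [mul_pow, hξ, one_mul, hκ]
    · rw [mul_assoc, mul_div_cancel₀ _ hκ0, hk]
  have h1 := hE (one_pow 3) (k := m) (by rw [one_mul, ha])
  have hζ2a : (ζ ^ 2 * a).im = (-m - n : ℤ) * Real.pi := by
    rw [eq_neg_of_add_eq_zero_left ((add_assoc _ _ _).symm.trans hζ), neg_mul, add_mul, one_mul,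
      Complex.neg_im, Complex.add_im, ha, hζa]
    push_cast
    ring
  have h2 := hE (by rw [← pow_mul, mul_comm, pow_mul, hζ3, one_pow]) hζ2a
  rw [one_mul] at h1
  apply smul_right_injective C3 (three_ne_zero (α := ℂ))
  simp only [← flatEigenfunction_add_add hζ F r κ, h1, hE hζ3 hζa, h2]

omit hκ0 hκ in
lemma descendsToTorus_of_const {f : ℂ → CP2} (hF : IsHorizontalLift f F) : DescendsToTorus f := by
  obtain ⟨κ, hκ⟩ := IsAlgClosed.exists_pow_nat_eq (-ψ) three_pos
  have hκ0 : κ ≠ 0 := by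
    rintro rfl
    have hr := h.mul_conj_eq_of_pow_three_eq hκ
    rw [zero_mul] at hr
    exact h.metric_ne_zero 0 hr.symm
  obtain ⟨ζ, hre, him⟩ : ∃ ζ : ℂ, ζ.re = -1 / 2 ∧ ζ.im = √3 / 2 := ⟨⟨_, _⟩, rfl, rfl⟩
  have hζ := sq_add_self_add_one_eq_zero hre him
  have hperiod {a : ℂ} (m n : ℤ) (ha : a.im = m * Real.pi) (hζa : (ζ * a).im = n * Real.pi)
      (z : ℂ) : f (z + a / κ) = f z :=
    (hF.period_iff _).2 ⟨1, norm_one, fun z => by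
      rw [add_comm, h.add_of_const hκ0 hκ hζ ha hζa, one_smul]⟩ z
  refine ⟨(2 * Real.pi / √3 : ℝ) / κ, (2 * Real.pi : ℝ) * Complex.I / κ,
    linearIndependent_ofReal_div_ofReal_mul_I_div (by positivity) (by positivity) hκ0,
    hperiod 0 1 (by simp) ?_, hperiod 2 (-1) (by simp) ?_⟩
  · rw [Complex.im_mul_ofReal, him]
    field_simp
    simp
  · rw [mul_left_comm, Complex.im_ofReal_mul, Complex.mul_I_im, hre]
    push_cast
    ring

end IsMinLagLift

/-! ### Equivariant surfaces and their associates -/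

namespace IsMinimalLagrangian

variable {f : ℂ → CP2} {F : ℂ → C3} (hf : IsMinimalLagrangian f F)
  (he : IsTranslationallyEquivariant f)
include hf he

lemma logFactor_real_add (t : ℝ) (z : ℂ) : logFactor F (t + z) = logFactor F z := by
  obtain ⟨U, hU⟩ := hf.lift.exists_linearIsometry_translation he t
  exact Real.exp_injective (hf.isMinLagLift.metric_hopf_add hU z).1

lemma logFactor_eq_im (z : ℂ) : logFactor F z = logFactor F (z.im * Complex.I) := by
  conv_lhs => rw [← Complex.re_add_im z, hf.logFactor_real_add he]

lemma hopf_eq (z z' : ℂ) : hopf F z = hopf F z' := by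
  refine hf.isMinLagLift.hopf_eq_of_translation_invariant (fun t z => ?_) z z'
  obtain ⟨U, hU⟩ := hf.lift.exists_linearIsometry_translation he t
  exact (hf.isMinLagLift.metric_hopf_add hU z).2

lemma isMinLagLift_of_isAssociate {f' : ℂ → CP2} {F' : ℂ → C3} {lam : ℂ}
    (hf' : IsMinimalLagrangian f' F') (h : IsAssociate lam F F') :
    IsMinLagLift F' (fun z => Real.exp (logFactor F (z.im * Complex.I)))
      fun _ => -Complex.I * lam⁻¹ ^ 3 * hopf F 0 := by
  have key := hf'.isMinLagLift
  simp only [funext fun z => (h z).1, funext fun z => (h z).2] at key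
  rwa [funext (hf.logFactor_eq_im he), funext fun z => hf.hopf_eq he z 0] at key

end IsMinimalLagrangian

lemma betaConst_congr {ψ ψ' : ℂ} (h : ‖ψ‖ = ‖ψ'‖) : betaConst ψ = betaConst ψ' := by
  ext
  rw [betaConst, betaConst, h]

lemma halfPeriod_congr {ψ ψ' : ℂ} (h : ‖ψ‖ = ‖ψ'‖) : halfPeriod ψ = halfPeriod ψ' := by
  ext
  simp only [halfPeriod, a2, a3, betaConst_congr h]

lemma norm_neg_I_mul_inv_pow_mul {lam : ℂ} (hlam : ‖lam‖ = 1) (ψ : ℂ) (n : ℕ) :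
    ‖-Complex.I * lam⁻¹ ^ n * ψ‖ = ‖ψ‖ := by
  simp [hlam]

namespace IsMinLagLift

variable {f : ℂ → CP2} {F : ℂ → C3} {u : ℝ → ℝ} {ψ lam : ℂ} {d : Fin 3 → ℝ}
  (h : IsMinLagLift F (fun z => Real.exp (u z.im)) fun _ => -Complex.I * lam⁻¹ ^ 3 * ψ)
  (hu0 : deriv u 0 = 0) (hlam : ‖lam‖ = 1)
  (hd : (potential ψ (u 0) lam).charpoly =
    ∏ j, (Polynomial.X - Polynomial.C (Complex.I * (d j : ℂ))))
include h

lemma contDiff_logFactor : ContDiff ℝ ∞ u := by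
  simpa using h.contDiff_profile.log fun _ => Real.exp_ne_zero _

include hu0

lemma deriv_exp_logFactor_zero : deriv (fun y => Real.exp (u y)) 0 = 0 := by
  rw [((h.contDiff_logFactor.differentiable (by simp) 0).hasDerivAt.exp).deriv, hu0, mul_zero]

include hlam hd

lemma exists_generator_eigenbasis (hinj : Function.Injective d) :
    ∃ (M : C3 →L[ℂ] C3) (B : Module.Basis (Fin 3) ℂ C3), (∀ z, fderiv ℝ F z 1 = M (F z)) ∧
      ∀ j, M (B j) = (Complex.I * d j) • B j := by
  obtain ⟨M, hM⟩ := h.exists_generator fun t z => by simp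
  have hmetric : wirtinger (fun z : ℂ => (Real.exp (u z.im) : ℂ)) 0 = 0 := by
    rw [h.wirtinger_profile (w := fun y => Real.exp (u y)), Complex.zero_im,
      h.deriv_exp_logFactor_zero hu0]
    simp
  have hmatrix := h.toMatrix_generator hM hlam (u₀ := u 0) (z := 0) (by simp) hmetric rfl
  have hchar : M.toLinearMap.charpoly =
      ∏ j, (Polynomial.X - Polynomial.C (Complex.I * (d j : ℂ))) := by
    rw [← hd, ← hmatrix, LinearMap.charpoly_toMatrix]
  obtain ⟨B, hB⟩ := exists_eigenbasis (injective_I_mul_ofReal hinj) hchar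
  exact ⟨M, B, hM, hB⟩

lemma descendsToTorus_iff_of_injective (hF : IsHorizontalLift f F) (hψ : ψ ≠ 0)
    (hne : ∃ y, u y ≠ u 0) (hinj : Function.Injective d) :
    DescendsToTorus f ↔ (d 1 = 0 ∨ ∃ q : ℚ, d 0 / d 1 = q) ∧
      ((lam⁻¹ ^ 3 * ψ).im = 0 ∨ ∃ q : ℚ, 1 / (2 * Real.pi) *
        (beta2 ψ lam u (2 * halfPeriod ψ (Real.exp (u 0)))).im *
          (d 0 * d 1 + 2 * betaConst ψ (Real.exp (u 0)) / 3) = q) := by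
  obtain ⟨M, B, hM, hB⟩ := h.exists_generator_eigenbasis hu0 hlam hd hinj
  obtain ⟨hsum, hβ, -⟩ := cubic_coefficients (cubic_of_charpoly_potential hlam hd)
  have hnorm := norm_neg_I_mul_inv_pow_mul hlam ψ 3
  have hψ' : -Complex.I * lam⁻¹ ^ 3 * ψ ≠ 0 := by rwa [← norm_ne_zero_iff, hnorm, norm_ne_zero_iff]
  have hre : (-Complex.I * lam⁻¹ ^ 3 * ψ).re = (lam⁻¹ ^ 3 * ψ).im := by
    rw [mul_assoc, neg_mul, Complex.neg_re, Complex.I_mul_re, neg_neg]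
  rw [h.descendsToTorus_iff_of_not_const hF (h.deriv_exp_logFactor_zero hu0) hψ'
    (hne.imp fun y => Real.exp_injective.ne) hM hB hinj hsum hβ, hre, halfPeriod_congr hnorm]
  refine and_congr_right fun _ => or_congr_right' fun him => ?_
  rw [im_beta2 hlam (h.contDiff_logFactor.of_le (by simp)) him]

lemma metric_const_and_im_eq_zero_of_not_injective (hinj : ¬ Function.Injective d) :
    (∀ y, Real.exp (u y) = Real.exp (u 0)) ∧ (lam⁻¹ ^ 3 * ψ).im = 0 := by
  have hnorm := norm_neg_I_mul_inv_pow_mul hlam ψ 3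
  obtain ⟨x, hβ, hx⟩ := exists_cubic_double_root (cubic_of_charpoly_potential hlam hd) hinj
  have hsq : ‖ψ‖ ^ 2 = x ^ 6 + (lam⁻¹ ^ 3 * ψ).im ^ 2 := by
    have hnorm' : ‖lam⁻¹ ^ 3 * ψ‖ = ‖ψ‖ := by simp [hlam]
    rw [← hnorm', ← Complex.normSq_eq_norm_sq, Complex.normSq_apply, hx]
    ring
  obtain ⟨hw, hψx⟩ := eq_sq_of_betaConst_eq (Real.exp_pos _) hβ (by rw [hsq]; nlinarith)
  refine ⟨(h.isProfile (h.deriv_exp_logFactor_zero hu0)).eq_const_of_pow_three_eq ?_, ?_⟩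
  · rw [hnorm, hψx, hw]
    ring
  · exact pow_eq_zero_iff two_ne_zero |>.1 (by linarith)

lemma descendsToTorus_of_not_injective (hF : IsHorizontalLift f F) (hinj : ¬ Function.Injective d) :
    DescendsToTorus f := by
  have hconst := (h.metric_const_and_im_eq_zero_of_not_injective hu0 hlam hd hinj).1
  simp only [hconst] at h
  exact h.descendsToTorus_of_const hF

end IsMinLagLift

end EquivMinLag

theorem mainTheorem5
    (f : ℂ → CP2) (F : ℂ → C3) (hf : IsMinimalLagrangian f F)
    (hequiv : IsTranslationallyEquivariant f)
    -- the metric along the imaginary axis, with the origin at a critical point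
    (u : ℝ → ℝ) (hu : ∀ y : ℝ, u y = logFactor F (y * Complex.I)) (hu0 : deriv u 0 = 0)
    (ψ : ℂ) (hψ : ψ = hopf F 0) (hψ0 : ψ ≠ 0)
    -- the member at `lam` of the associated family
    (lam : ℂ) (hlam : ‖lam‖ = 1)
    (f' : ℂ → CP2) (F' : ℂ → C3) (hf' : IsMinimalLagrangian f' F')
    (hassoc : IsAssociate lam F F')
    -- the eigenvalues `i d 0, i d 1, i d 2` of the potential, in any order
    (d : Fin 3 → ℝ)
    (hd : (potential ψ (u 0) lam).charpoly =
      ∏ j, (Polynomial.X - Polynomial.C (Complex.I * (d j : ℂ))))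
    -- the surface is not flat, or there is a multiple eigenvalue
    (hflat : (∃ y, u y ≠ u 0) ∨ ¬ Function.Injective d)
    (β T : ℝ) (hβ : β = betaConst ψ (Real.exp (u 0)))
    (hT : T = halfPeriod ψ (Real.exp (u 0))) :
    DescendsToTorus f' ↔
      (d 1 = 0 ∨ ∃ q : ℚ, d 0 / d 1 = q) ∧
      (d 0 = d 1 ∨ (lam⁻¹ ^ 3 * ψ).im = 0 ∨
        ∃ q : ℚ, 1 / (2 * Real.pi) * (beta2 ψ lam u (2 * T)).im * (d 0 * d 1 + 2 * β / 3) = q) := by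
  obtain rfl : u = fun y : ℝ => logFactor F (y * Complex.I) := funext hu
  subst hψ hβ hT
  have h := hf.isMinLagLift_of_isAssociate hequiv hf' hassoc
  by_cases hinj : Function.Injective d
  · have hne := hflat.resolve_right (not_not.2 hinj)
    rw [or_iff_right (hinj.ne (by decide) : d 0 ≠ d 1)]
    exact h.descendsToTorus_iff_of_injective hu0 hlam hd hf'.lift hψ0 hne hinj
  · obtain ⟨hsum, -, -⟩ := cubic_coefficients (cubic_of_charpoly_potential hlam hd)
    have him := (h.metric_const_and_im_eq_zero_of_not_injective hu0 hlam hd hinj).2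
    exact iff_of_true (h.descendsToTorus_of_not_injective hu0 hlam hd hf'.lift hinj)
      ⟨exists_rat_div_of_not_injective hinj hsum, Or.inr (Or.inl him)⟩
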